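/- Let $D=\,]0,\infty[\,\times\mathbb R$. For $z=(t,x_1,x_2)$ and $w=(T,y_1,y_2)$ in $\mathbb R\times D$ write $z\prec w$ if $t<T$ and $x_2<y_2$, and then put $$\mathbf h(z;w)=\frac{(T-t)\sqrt{x_1y_1}}{y_2-x_2}.$$ Let $\Psi(z;w)=\min_\omega\int_t^T|\omega(s)|^2\,ds$, the minimum being over all $\omega\in L^2([t,T])$ for which there is a (Carathéodory) solution $\gamma=(\gamma_1,\gamma_2)$ on $[t,T]$ of $$\dot\gamma_1=\omega\gamma_1,\qquad \dot\gamma_2=\gamma_1,\qquad \gamma(t)=(x_1,x_2),\qquad \gamma(T)=(y_1,y_2).$$ A curve $\gamma$ associated with a minimizing $\omega$ is called an optimal curve from $z$ to $w$. Set $$f(z;w)=\frac{2}{T-t}-\frac{x_1^2\,\partial_{x_1x_1}\Psi(z;w)}{4},\qquad \mathbf u(z;w)=\exp\Big(\int_t^T f\big(s,\gamma(s);w\big)\,ds\Big),\qquad z\prec w,$$ where $\gamma$ is the optimal curve from $z$ to $w$. Let $g:\,]-\pi^2,\infty[\,\to\,]0,\infty[$, $g(r)=\frac{\sinh\sqrt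 r}{\sqrt r}$ (that is, $g(0)=1$ and $g(r)=\frac{\sin\sqrt{-r}}{\sqrt{-r}}$ for $r<0$). **Proposition.** 1. (Well-posedness.) The function $g$ is a bijection from $]-\pi^2,\infty[$ onto $]0,\infty[$. For all $z\prec w$ an optimal curve $\gamma$ from $z$ to $w$ exists and is unique on $[t,T]$, it satisfies $(s,\gamma(s))\prec w$ for $s\in[t,T[$, the function $x_1\mapsto\Psi(t,x_1,x_2;w)$ is twice continuously differentiable on $]0,\infty[$, and $s\mapsto f(s,\gamma(s);w)$ is integrable on $]t,T[$. Hence $\mathbf u$ is well defined. 2. (Closed form.) For all $z\prec w$, $$\mathbf u(z;w)=v\Big(4\,g^{-1}\Big(\frac1{\mathbf h(z;w)}\Big)\Big),\qquad v(\eta)=\begin{cases}\dfrac{|\eta|}{2\sqrt{3\sqrt\eta\,\sinh\sqrt\eta-6\cosh\sqrt\eta+6}},&\eta\in\,]-4\pi^2,\infty[\,\setminus\{0\},\\[2mm]1,&\eta=0,\end{cases}$$ where for $\eta<0$ one reads $\sqrt\eta\,\sinh\sqrt\eta=-\sqrt{-\eta}\,\sin\sqrt{-\eta}$ and $\cosh\sqrt\eta=\cos\sqrt{-\eta}$.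 3. (Regularity and transport equation.) For every $w\in\mathbb R\times D$ the function $\mathbf u(\cdot\,;w)$ is $C^\infty$ on $\{z:z\prec w\}$, and for all $z\prec w$ $$\Big(\partial_t+x_1\partial_{x_2}-\frac{x_1^2}{2}\,\partial_{x_1}\Psi(z;w)\,\partial_{x_1}\Big)\mathbf u(z;w)+f(z;w)\,\mathbf u(z;w)=0.$$ 4. (Bounds.) There is a universal constant $\kappa>0$ such that for all $z\prec w$ $$\kappa^{-1}\,\mathbf 1_{]0,1]}\big(\mathbf h(z;w)\big)\,\mathbf h(z;w)\le|\mathbf u(z;w)|\le\kappa\big(\sqrt{\mathbf h(z;w)}+\mathbf h(z;w)\big),\qquad \big|x_1^2\,\partial_{x_1x_1}\mathbf u(z;w)\big|\le\kappa\sqrt{\mathbf h(z;w)}.$$ -/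

import Mathlib

open Real Set MeasureTheory
open scoped ContDiff

noncomputable section

namespace AsianTransport

/-- Space-time points `z = (t, x₁, x₂)`: `z.1 = t`, `z.2.1 = x₁`, `z.2.2 = x₂`. -/
abbrev Pt : Type := ℝ × ℝ × ℝ

/-- Membership in `ℝ × D`, where `D = ]0, ∞[ × ℝ`. -/
def InDomain (z : Pt) : Prop := 0 < z.2.1

/-- `z ≺ w` for `z = (t, x)` and `w = (T, y)`, both points of `ℝ × D`: `t < T` and `x₂ < y₂`. -/
def Prec (z w : Pt) : Prop :=
  InDomain z ∧ InDomain w ∧ z.1 < w.1 ∧ z.2.2 < w.2.2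

/-! ### The optimal control problem (with `σ = 1`) -/

/-- The control `c ∈ L²([t, T])` steers `z = (t, x)` to `w = (T, y)` along the curve `γ`:
`γ₁' = c γ₁`, `γ₂' = γ₁` on `]t, T[`, with `γ(t) = x` and `γ(T) = y`. As `c` is only square
integrable, the differential equations are understood in the sense of Carathéodory, that is, in
integrated form (the integrands below are integrable, since `γ` is continuous). -/
structure IsAdmissible (z w : Pt) (c : ℝ → ℝ) (γ : ℝ → ℝ × ℝ) : Prop where
  memLp : MemLp c 2 (volume.restrict (Icc z.1 w.1))
  continuousOn : ContinuousOn γ (Icc z.1 w.1)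
  eq_fst : ∀ s ∈ Icc z.1 w.1, (γ s).1 = z.2.1 + ∫ r in z.1..s, c r * (γ r).1
  eq_snd : ∀ s ∈ Icc z.1 w.1, (γ s).2 = z.2.2 + ∫ r in z.1..s, (γ r).1
  terminal : γ w.1 = w.2

/-- The cost `∫ₜᵀ |c(s)|² ds` of a control. -/
def cost (z w : Pt) (c : ℝ → ℝ) : ℝ := ∫ s in z.1..w.1, |c s| ^ 2

/-- `c` is an optimal control from `z` to `w`, and `γ` its trajectory. -/
def IsOptimal (z w : Pt) (c : ℝ → ℝ) (γ : ℝ → ℝ × ℝ) : Prop :=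
  IsAdmissible z w c γ ∧ ∀ c' γ', IsAdmissible z w c' γ' → cost z w c ≤ cost z w c'

/-- `γ` is an optimal trajectory (optimal curve) from `z` to `w`. -/
def IsOptimalCurve (z w : Pt) (γ : ℝ → ℝ × ℝ) : Prop := ∃ c, IsOptimal z w c γ

/-- The cost function `Ψ(z; w)`: the optimal value of the control problem. -/
def Psi (z w : Pt) : ℝ := sInf {m | ∃ c γ, IsAdmissible z w c γ ∧ m = cost z w c}

/-- The optimal curve from `z` to `w`. -/
def optimalCurve (z w : Pt) : ℝ → ℝ × ℝ := Classical.epsilon (IsOptimalCurve z w)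

/-! ### Partial derivatives -/

/-- `∂ₜ F`. -/
def partialT (F : Pt → ℝ) (z : Pt) : ℝ := deriv (fun r => F (r, z.2.1, z.2.2)) z.1

/-- `∂_{x₁} F`. -/
def partialX₁ (F : Pt → ℝ) (z : Pt) : ℝ := deriv (fun r => F (z.1, r, z.2.2)) z.2.1

/-- `∂_{x₂} F`. -/
def partialX₂ (F : Pt → ℝ) (z : Pt) : ℝ := deriv (fun r => F (z.1, z.2.1, r)) z.2.2

/-- The vector field `Y = ∂ₜ + x₁ ∂_{x₂}`. -/
def fieldY (F : Pt → ℝ) (z : Pt) : ℝ := partialT F z + z.2.1 * partialX₂ F z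

/-! ### The transport correction -/

/-- `f(z; w) = 2 / (T - t) - x₁² ∂_{x₁x₁} Ψ(z; w) / 4`. -/
def fCoeff (z w : Pt) : ℝ :=
  2 / (w.1 - z.1) - z.2.1 ^ 2 * partialX₁ (partialX₁ fun ζ => Psi ζ w) z / 4

/-- The drift coefficient `x₁² / 2 * ∂_{x₁} Ψ(z; w)` of the transport equation. -/
def driftCoeff (z w : Pt) : ℝ := z.2.1 ^ 2 / 2 * partialX₁ (fun ζ => Psi ζ w) z

/-- `u(z; w) = exp (∫ₜᵀ f(s, γ(s); w) ds)`, where `γ` is the optimal curve from `z` to `w`. -/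
def uCorr (z w : Pt) : ℝ :=
  exp (∫ s in z.1..w.1, fCoeff (s, optimalCurve z w s) w)

/-! ### The functions in the closed form -/

/-- `h(z; w) = (T - t) √(x₁ y₁) / (y₂ - x₂)`. -/
def hFun (z w : Pt) : ℝ := (w.1 - z.1) * √(z.2.1 * w.2.1) / (w.2.2 - z.2.2)

/-- `g(r) = sinh √r / √r` for `r > -π²`, in real form. -/
def gFun (r : ℝ) : ℝ :=
  if 0 < r then sinh (√r) / √r
  else if r = 0 then 1
  else sin (√(-r)) / √(-r)

/-- The inverse of `g : ]-π², ∞[ → ]0, ∞[`. -/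
def gInv : ℝ → ℝ := Function.invFunOn gFun (Ioi (-π ^ 2))

/-- `v(η) = |η| / (2 √(3 √η sinh √η - 6 cosh √η + 6))` for `η ≠ 0`, `η > -4π²`, and `v(0) = 1`;
for `η < 0` one has `√η sinh √η = -√(-η) sin √(-η)` and `cosh √η = cos √(-η)`. -/
def vFun (η : ℝ) : ℝ :=
  if 0 < η then |η| / (2 * √(3 * √η * sinh (√η) - 6 * cosh (√η) + 6))
  else if η = 0 then 1
  else |η| / (2 * √(-(3 * √(-η) * sin (√(-η))) - 6 * cos (√(-η)) + 6))

end AsianTransport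

end

open AsianTransport

open Filter Topology

namespace AsianTransport

/-! ### The function `g` as an entire function -/

/-! Put φ = γ₁^(-1/2), so that ω = -2φ'/φ. The extremals are given by φ'' = Eφ with E constant, and
γ₂ is then, up to a constant, a quotient of two solutions. Fitting the endpoints gives g(ρ) = 1/h
with ρ = E(T-t)². The condition ρ > -π² says that the solution `sinE` vanishing at 0 stays positive
on ]0, T-t].

Global optimality comes from Möbius invariance. Replacing γ₂ by -1/(γ₂-p), with p < x₂, turns ω into
ω - 2γ₁/(γ₂-p) and changes the cost by boundary terms only. When p is the value of the extremal at a
time slightly before t, the new extremal control has derivative k γ₁/(γ₂-p)² with k ≥ 0. Integration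
by parts and log x ≤ x - 1 then show that the excess cost of any competitor is at least the squared
L² distance between the shifted controls (`cost_add_integral_sq_le`). This yields both minimality
and uniqueness.

The energy E is constant along the curve, so ρ(s, γ(s)) = E(T-s)² (`rho_extremal`). From the
explicit Ψ (`psi_eq`) and the equation 2r g'' = g/2 - 3g' one finds f = -(ρ/τ) (log(g g'))'(ρ),
where τ = T-t (`fCoeff_eq`). Along the curve this is the exact derivative of ½ log(g g')(E(T-s)²).
Since g(0) g'(0) = 1/6, it follows that u = (6 g(ρ) g'(ρ))^(-1/2) (`uCorr_eq`).

The closed form is then a double-angle identity, smoothness follows from the inverse function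
theorem for g, and the transport operator sends ρ to -2ρ/τ. For the bounds, h = 1/g(ρ): g' is
bounded below by a positive constant, 6g' ≤ g on r ≥ 0, and the ratios of derivatives of g that
enter the second derivative are bounded. -/

theorem gFun_of_pos {r : ℝ} (hr : 0 < r) : gFun r = sinh (√r) / √r := by
  simp [gFun, hr]

theorem gFun_zero : gFun 0 = 1 := by simp [gFun]

theorem gFun_of_neg {r : ℝ} (hr : r < 0) : gFun r = sin (√(-r)) / √(-r) := by
  simp [gFun, hr.not_gt, hr.ne]

/-- The sine and hyperbolic sine branches share one power series, so g is entire and no case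
distinction at 0 is needed for smoothness. -/
theorem hasSum_gFun (r : ℝ) :
    HasSum (fun n : ℕ => ((2 * n + 1).factorial : ℝ)⁻¹ * r ^ n) (gFun r) := by
  rcases lt_trichotomy r 0 with hr | rfl | hr
  · rw [gFun_of_neg hr]
    have hs : 0 < √(-r) := Real.sqrt_pos.2 (by linarith)
    have h := (Real.hasSum_sin (√(-r))).div_const (√(-r))
    convert! h using 2 with n
    rw [pow_succ (√(-r)), pow_mul (√(-r)), Real.sq_sqrt (by linarith), neg_pow r n]
    have : ((-1 : ℝ) ^ n) * (-1) ^ n = 1 := by rw [← mul_pow]; simp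
    field_simp
    linear_combination (-r ^ n) * this
  · rw [gFun_zero]
    convert! hasSum_single (f := fun n : ℕ => ((2 * n + 1).factorial : ℝ)⁻¹ * (0 : ℝ) ^ n) 0 ?_
    · simp
    · intro n hn
      simp [hn]
  · rw [gFun_of_pos hr]
    have hs : 0 < √r := Real.sqrt_pos.2 hr
    have h := (Real.hasSum_sinh (√r)).div_const (√r)
    convert! h using 2 with n
    rw [pow_succ, pow_mul, Real.sq_sqrt hr.le]
    field_simp

theorem contDiff_gFun {n : WithTop ℕ∞} : ContDiff ℝ n gFun := by
  set c : ℕ → ℝ := fun n => ((2 * n + 1).factorial : ℝ)⁻¹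
  have hc : (FormalMultilinearSeries.ofScalars ℝ c).radius = ⊤ := by
    apply FormalMultilinearSeries.ofScalars_radius_eq_top_of_tendsto
    · exact Eventually.of_forall fun n => by positivity
    · have : ∀ n : ℕ, ‖c n.succ‖ / ‖c n‖ = ((2 * n + 2 : ℝ) * (2 * n + 3))⁻¹ := by
        intro n
        have : (2 * n.succ + 1).factorial = (2 * n + 3) * ((2 * n + 2) * (2 * n + 1).factorial) := by
          rw [show 2 * n.succ + 1 = (2 * n + 1 + 1) + 1 by omega, Nat.factorial_succ,
            Nat.factorial_succ]
        simp only [c, this, norm_inv]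
        simp only [Real.norm_natCast]
        push_cast
        have := Nat.factorial_pos (2 * n + 1)
        field_simp
      simp_rw [this]
      refine squeeze_zero (fun n => by positivity) (fun n => ?_) tendsto_one_div_add_atTop_nhds_zero_nat
      rw [one_div]
      gcongr
      nlinarith [n.cast_nonneg (α := ℝ)]
  have hf := (FormalMultilinearSeries.ofScalars ℝ c).hasFPowerSeriesOnBall (by rw [hc]; simp)
  rw [hc] at hf
  have : (FormalMultilinearSeries.ofScalars ℝ c).sum = gFun := by
    funext r
    rw [← FormalMultilinearSeries.ofScalarsSum.eq_1, FormalMultilinearSeries.ofScalarsSum_eq_tsum]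
    simpa [c] using (hasSum_gFun r).tsum_eq
  rw [this] at hf
  have h2 : AnalyticOnNhd ℝ gFun univ := by simpa using hf.analyticOnNhd
  exact h2.contDiff

/-- The derivative of `g`. -/
noncomputable def gDer (r : ℝ) : ℝ := deriv gFun r

/-- The function `cosh √r`, entire in `r`. -/
noncomputable def coshSqrt (r : ℝ) : ℝ := gFun r + 2 * r * gDer r

theorem hasDerivAt_gFun (r : ℝ) : HasDerivAt gFun (gDer r) r :=
  ((contDiff_gFun (n := 1)).differentiable (by simp) r).hasDerivAt

theorem contDiff_gDer {n : ℕ∞} : ContDiff ℝ n gDer := by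
  have h : ContDiff ℝ (n + 1 : WithTop ℕ∞) gFun := contDiff_gFun
  exact (contDiff_succ_iff_deriv.1 h).2.2

theorem contDiff_coshSqrt {n : ℕ∞} : ContDiff ℝ n coshSqrt :=
  contDiff_gFun.add ((contDiff_const.mul contDiff_id).mul contDiff_gDer)

theorem coshSqrt_of_pos {r : ℝ} (hr : 0 < r) : coshSqrt r = cosh (√r) := by
  have hs : 0 < √r := Real.sqrt_pos.2 hr
  have h1 : HasDerivAt (fun r => sinh (√r) / √r) _ r :=
    ((Real.hasDerivAt_sqrt hr.ne').sinh).div (Real.hasDerivAt_sqrt hr.ne') hs.ne'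
  have h2 : gFun =ᶠ[𝓝 r] fun r => sinh (√r) / √r := by
    filter_upwards [lt_mem_nhds hr] with x hx using gFun_of_pos hx
  rw [coshSqrt, gDer, h2.deriv_eq, h1.deriv, gFun_of_pos hr]
  have := Real.sq_sqrt hr.le
  generalize √r = x at *
  subst this
  field_simp
  ring

theorem coshSqrt_of_neg {r : ℝ} (hr : r < 0) : coshSqrt r = cos (√(-r)) := by
  have hr' : 0 < -r := by linarith
  have hs : 0 < √(-r) := Real.sqrt_pos.2 hr'
  have h0 : HasDerivAt (fun r => √(-r)) _ r := (hasDerivAt_neg r).sqrt hr'.ne'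
  have h1 : HasDerivAt (fun r => sin (√(-r)) / √(-r)) _ r := h0.sin.div h0 hs.ne'
  have h2 : gFun =ᶠ[𝓝 r] fun r => sin (√(-r)) / √(-r) := by
    filter_upwards [gt_mem_nhds hr] with x hx using gFun_of_neg hx
  rw [coshSqrt, gDer, h2.deriv_eq, h1.deriv, gFun_of_neg hr]
  have := Real.sq_sqrt hr'.le
  generalize √(-r) = x at *
  obtain rfl : r = - x ^ 2 := by linarith
  field_simp
  ring

theorem coshSqrt_zero : coshSqrt 0 = 1 := by simp [coshSqrt, gFun_zero]

theorem hasDerivAt_coshSqrt (r : ℝ) : HasDerivAt coshSqrt (gFun r / 2) r := by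
  have hd : Differentiable ℝ coshSqrt := (contDiff_coshSqrt (n := 1)).differentiable (by simp)
  have hc : Continuous (deriv coshSqrt) :=
    (contDiff_coshSqrt (n := 1)).continuous_deriv (by simp)
  have hne : ∀ r ≠ 0, deriv coshSqrt r = gFun r / 2 := by
    intro r hr
    rcases hr.lt_or_gt with hr | hr
    · have hr' : 0 < -r := by linarith
      have h0 : HasDerivAt (fun r => √(-r)) _ r := (hasDerivAt_neg r).sqrt hr'.ne'
      have h2 : coshSqrt =ᶠ[𝓝 r] fun r => cos (√(-r)) := by
        filter_upwards [gt_mem_nhds hr] with x hx using coshSqrt_of_neg hx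
      rw [h2.deriv_eq, h0.cos.deriv, gFun_of_neg hr]
      ring
    · have h2 : coshSqrt =ᶠ[𝓝 r] fun r => cosh (√r) := by
        filter_upwards [lt_mem_nhds hr] with x hx using coshSqrt_of_pos hx
      rw [h2.deriv_eq, (Real.hasDerivAt_sqrt hr.ne').cosh.deriv, gFun_of_pos hr]
      ring
  have heq : deriv coshSqrt = fun r => gFun r / 2 :=
    -- The formula is known off 0 and both sides are continuous, so it extends to r = 0.
    Continuous.ext_on (dense_compl_singleton (0 : ℝ)) hc
      ((contDiff_gFun (n := 0)).continuous.div_const 2) fun r hr => hne r hr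
  rw [← congrFun heq r]
  exact (hd r).hasDerivAt

theorem coshSqrt_sq (r : ℝ) : coshSqrt r ^ 2 = 1 + r * gFun r ^ 2 := by
  rcases lt_trichotomy r 0 with hr | rfl | hr
  · have hr' : 0 < -r := by linarith
    have hs : 0 < √(-r) := Real.sqrt_pos.2 hr'
    rw [coshSqrt_of_neg hr, gFun_of_neg hr]
    have := Real.sq_sqrt hr'.le
    have h2 := sin_sq_add_cos_sq (√(-r))
    generalize √(-r) = x at *
    obtain rfl : r = - x ^ 2 := by linarith
    field_simp
    linarith
  · simp [coshSqrt_zero]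
  · have hs : 0 < √r := Real.sqrt_pos.2 hr
    rw [coshSqrt_of_pos hr, gFun_of_pos hr]
    have := Real.sq_sqrt hr.le
    have h2 := cosh_sq (√r)
    generalize √r = x at *
    subst this
    field_simp
    linarith

/-- The second derivative of `g`. -/
noncomputable def gDer₂ (r : ℝ) : ℝ := deriv gDer r

theorem hasDerivAt_gDer (r : ℝ) : HasDerivAt gDer (gDer₂ r) r :=
  ((contDiff_gDer (n := 1)).differentiable (by simp) r).hasDerivAt

theorem contDiff_gDer₂ {n : ℕ∞} : ContDiff ℝ n gDer₂ := by
  have h : ContDiff ℝ (n + 1 : WithTop ℕ∞) gDer := by exact_mod_cast contDiff_gDer (n := n + 1)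
  exact (contDiff_succ_iff_deriv.1 h).2.2

/-- Differentiate g + 2r g' and compare with (cosh √r)' = g/2. This equation eliminates all higher
derivatives of g later on. -/
theorem two_mul_gDer₂ (r : ℝ) : 2 * r * gDer₂ r = gFun r / 2 - 3 * gDer r := by
  have h : HasDerivAt coshSqrt _ r :=
    (hasDerivAt_gFun r).add (((hasDerivAt_id r).const_mul 2).mul (hasDerivAt_gDer r))
  have := h.unique (hasDerivAt_coshSqrt r)
  simp only [id, mul_one] at this
  linarith

theorem gDer_zero : gDer 0 = 1 / 6 := by
  have := two_mul_gDer₂ 0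
  rw [gFun_zero] at this
  linarith

/-! ### Positivity, monotonicity and bijectivity of g -/

theorem gFun_pos {r : ℝ} (hr : -π ^ 2 < r) : 0 < gFun r := by
  rcases lt_trichotomy r 0 with h | rfl | h
  · have hs : 0 < √(-r) := Real.sqrt_pos.2 (by linarith)
    rw [gFun_of_neg h]
    refine div_pos (sin_pos_of_pos_of_lt_pi hs ?_) hs
    rw [Real.sqrt_lt' pi_pos]
    linarith
  · simp [gFun_zero]
  · have hs : 0 < √r := Real.sqrt_pos.2 h
    rw [gFun_of_pos h]
    exact div_pos (sinh_pos_iff.2 hs) hs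

theorem gFun_neg_pi_sq : gFun (-π ^ 2) = 0 := by
  rw [gFun_of_neg (by have := pi_pos; nlinarith)]
  simp [Real.sqrt_sq pi_pos.le]

theorem sinh_lt_mul_cosh {x : ℝ} (hx : 0 < x) : sinh x < x * cosh x := by
  have hd : ∀ y, HasDerivAt (fun y => y * cosh y - sinh y) (y * sinh y) y := fun y => by
    have := ((hasDerivAt_id y).mul (hasDerivAt_cosh y)).sub (hasDerivAt_sinh y)
    convert! this using 1
    simp
  have := strictMonoOn_of_deriv_pos (convex_Ici (0 : ℝ)) (f := fun y => y * cosh y - sinh y)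
    (fun y _ => (hd y).continuousAt.continuousWithinAt) (fun y hy => by
      rw [interior_Ici, mem_Ioi] at hy
      rw [(hd y).deriv]
      exact mul_pos hy (sinh_pos_iff.2 hy)) self_mem_Ici (mem_Ici.2 hx.le) hx
  simp at this
  linarith

theorem mul_cos_lt_sin {x : ℝ} (hx : 0 < x) (hx' : x ≤ π) : x * cos x < sin x := by
  have hd : ∀ y, HasDerivAt (fun y => sin y - y * cos y) (y * sin y) y := fun y => by
    have := (hasDerivAt_sin y).sub ((hasDerivAt_id y).mul (hasDerivAt_cos y))
    convert! this using 1
    simp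
  have := strictMonoOn_of_deriv_pos (convex_Icc (0 : ℝ) π) (f := fun y => sin y - y * cos y)
    (fun y _ => (hd y).continuousAt.continuousWithinAt) (fun y hy => by
      rw [interior_Icc] at hy
      rw [(hd y).deriv]
      exact mul_pos hy.1 (sin_pos_of_mem_Ioo hy)) (left_mem_Icc.2 pi_pos.le) ⟨hx.le, hx'⟩ hx
  simp at this
  linarith

/-- Since 2r g' = cosh √r - g, the sign follows from comparing tanh x and tan x with x in product
form. The endpoint -π² is included so that compactness can be used on closed intervals. -/
theorem gDer_pos {r : ℝ} (hr : -π ^ 2 ≤ r) : 0 < gDer r := by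
  rcases lt_trichotomy r 0 with h | rfl | h
  · have hr' : 0 < -r := by linarith
    have hs : 0 < √(-r) := Real.sqrt_pos.2 hr'
    have h1 : √(-r) ≤ π := by
      rw [Real.sqrt_le_left pi_pos.le]; linarith
    have h2 := mul_cos_lt_sin hs h1
    have h3 := coshSqrt_of_neg h
    rw [coshSqrt, gFun_of_neg h] at h3
    have h4 : cos (√(-r)) < sin (√(-r)) / √(-r) := by rwa [lt_div_iff₀' hs]
    nlinarith
  · rw [gDer_zero]; norm_num
  · have hs : 0 < √r := Real.sqrt_pos.2 h
    have h2 := sinh_lt_mul_cosh hs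
    have h3 := coshSqrt_of_pos h
    rw [coshSqrt, gFun_of_pos h] at h3
    have h4 : sinh (√r) / √r < cosh (√r) := by rwa [div_lt_iff₀' hs]
    nlinarith

theorem strictMonoOn_gFun : StrictMonoOn gFun (Ici (-π ^ 2)) :=
  strictMonoOn_of_deriv_pos (convex_Ici _) (contDiff_gFun (n := 0)).continuous.continuousOn
    fun r hr => by
      rw [interior_Ici] at hr
      exact gDer_pos (le_of_lt hr)

theorem one_add_div_six_le_gFun {r : ℝ} (hr : 0 ≤ r) : 1 + r / 6 ≤ gFun r := by
  have h := (hasSum_gFun r).summable.sum_le_tsum (Finset.range 2) fun n _ => by positivity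
  rw [(hasSum_gFun r).tsum_eq] at h
  simp [Finset.sum_range_succ, Nat.factorial] at h
  linarith

theorem bijOn_gFun : BijOn gFun (Ioi (-π ^ 2)) (Ioi 0) := by
  refine ⟨fun r hr => gFun_pos hr, (strictMonoOn_gFun.mono Ioi_subset_Ici_self).injOn, ?_⟩
  intro y hy
  -- The point 6y works as upper end because g(6y) ≥ 1 + y > y.
  have hp : (-π ^ 2 : ℝ) ≤ 6 * y := by nlinarith [pi_pos, mem_Ioi.1 hy]
  have h := intermediate_value_Ioc hp (contDiff_gFun (n := 0)).continuous.continuousOn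
  have hy' : y ∈ Ioc (gFun (-π ^ 2)) (gFun (6 * y)) := by
    rw [gFun_neg_pi_sq]
    exact ⟨hy, by linarith [one_add_div_six_le_gFun (r := 6 * y) (by linarith [mem_Ioi.1 hy])]⟩
  obtain ⟨r, hr, rfl⟩ := h hy'
  exact ⟨r, hr.1, rfl⟩

/-! ### The inverse of `g` -/

theorem gInv_gt {m : ℝ} (hm : 0 < m) : -π ^ 2 < gInv m :=
  Function.invFunOn_mem (bijOn_gFun.surjOn hm)

theorem gFun_gInv {m : ℝ} (hm : 0 < m) : gFun (gInv m) = m :=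
  Function.invFunOn_eq (bijOn_gFun.surjOn hm)

theorem gInv_gFun {r : ℝ} (hr : -π ^ 2 < r) : gInv (gFun r) = r :=
  bijOn_gFun.injOn (gInv_gt (gFun_pos hr)) hr (gFun_gInv (gFun_pos hr))

theorem continuousAt_gInv {m : ℝ} (hm : 0 < m) : ContinuousAt gInv m := by
  have hmono : StrictMonoOn gInv (Ioi 0) := fun a ha b hb hab => by
    rw [← (strictMonoOn_gFun.mono Ioi_subset_Ici_self).lt_iff_lt (gInv_gt ha) (gInv_gt hb),
      gFun_gInv ha, gFun_gInv hb]
    exact hab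
  refine hmono.continuousAt_of_image_mem_nhds (Ioi_mem_nhds hm) ?_
  refine mem_of_superset (Ioi_mem_nhds (gInv_gt hm)) fun r hr => ?_
  exact ⟨gFun r, gFun_pos hr, gInv_gFun hr⟩

/-- The restriction of `g` to `]-π², ∞[` as a homeomorphism onto `]0, ∞[`. -/
noncomputable def gHomeomorph : OpenPartialHomeomorph ℝ ℝ where
  toFun := gFun
  invFun := gInv
  source := Ioi (-π ^ 2)
  target := Ioi 0
  map_source' _ hr := gFun_pos hr
  map_target' _ hm := gInv_gt hm
  left_inv' _ hr := gInv_gFun hr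
  right_inv' _ hm := gFun_gInv hm
  open_source := isOpen_Ioi
  open_target := isOpen_Ioi
  continuousOn_toFun := (contDiff_gFun (n := 0)).continuous.continuousOn
  continuousOn_invFun _ hm := (continuousAt_gInv hm).continuousWithinAt

theorem contDiffAt_gInv {m : ℝ} (hm : 0 < m) {n : WithTop ℕ∞} : ContDiffAt ℝ n gInv m :=
  gHomeomorph.contDiffAt_symm_deriv (gDer_pos (gInv_gt hm).le).ne' hm (hasDerivAt_gFun _)
    contDiff_gFun.contDiffAt

theorem hasDerivAt_gInv {m : ℝ} (hm : 0 < m) : HasDerivAt gInv (gDer (gInv m))⁻¹ m :=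
  gHomeomorph.hasDerivAt_symm hm (gDer_pos (gInv_gt hm).le).ne' (hasDerivAt_gFun _)

/-! ### Primitives in the sense of Carathéodory -/

/-- `F` is absolutely continuous between `a` and `b`, with almost everywhere derivative `f`. -/
structure IsPrimitive (F f : ℝ → ℝ) (a b : ℝ) : Prop where
  ac : AbsolutelyContinuousOnInterval F a b
  ae_hasDerivAt : ∀ᵐ x, x ∈ uIcc a b → HasDerivAt F (f x) x

theorem _root_.AbsolutelyContinuousOnInterval.congr_eqOn {F G : ℝ → ℝ} {a b : ℝ}
    (hF : AbsolutelyContinuousOnInterval F a b) (h : EqOn F G (uIcc a b)) :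
    AbsolutelyContinuousOnInterval G a b := by
  refine Tendsto.congr' ?_ hF
  have : ∀ᶠ E in AbsolutelyContinuousOnInterval.totalLengthFilter ⊓
      𝓟 (AbsolutelyContinuousOnInterval.disjWithin a b),
      E ∈ AbsolutelyContinuousOnInterval.disjWithin a b := eventually_inf_principal.mpr (by simp)
  filter_upwards [this] with E hE
  refine Finset.sum_congr rfl fun i hi => ?_
  rw [h (hE.1 i hi).1, h (hE.1 i hi).2]

theorem _root_.AbsolutelyContinuousOnInterval.lipschitzOnWith_comp {F H : ℝ → ℝ} {a b : ℝ}
    {K : NNReal} {s : Set ℝ} (hF : AbsolutelyContinuousOnInterval F a b)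
    (hH : LipschitzOnWith K H s) (hs : MapsTo F (uIcc a b) s) :
    AbsolutelyContinuousOnInterval (fun x => H (F x)) a b := by
  have h0 := Tendsto.const_mul (K : ℝ) hF
  rw [mul_zero] at h0
  refine squeeze_zero' (Eventually.of_forall fun E => Finset.sum_nonneg fun _ _ => dist_nonneg)
    ?_ h0
  have : ∀ᶠ E in AbsolutelyContinuousOnInterval.totalLengthFilter ⊓
      𝓟 (AbsolutelyContinuousOnInterval.disjWithin a b),
      E ∈ AbsolutelyContinuousOnInterval.disjWithin a b := eventually_inf_principal.mpr (by simp)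
  filter_upwards [this] with E hE
  rw [Finset.mul_sum]
  exact Finset.sum_le_sum fun i hi =>
    hH.dist_le_mul _ (hs (hE.1 i hi).1) _ (hs (hE.1 i hi).2)

namespace IsPrimitive

variable {F G f g : ℝ → ℝ} {a b : ℝ}

theorem continuousOn (hF : IsPrimitive F f a b) : ContinuousOn F (uIcc a b) :=
  hF.ac.continuousOn

theorem deriv_ae_eq (hF : IsPrimitive F f a b) : ∀ᵐ x, x ∈ uIoc a b → deriv F x = f x := by
  filter_upwards [hF.ae_hasDerivAt] with x hx hx'
  exact (hx (uIoc_subset_uIcc hx')).deriv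

theorem intervalIntegrable (hF : IsPrimitive F f a b) : IntervalIntegrable f volume a b :=
  hF.ac.intervalIntegrable_deriv.congr_ae
    ((ae_restrict_iff' measurableSet_uIoc).2 hF.deriv_ae_eq)

theorem mono {c d : ℝ} (hF : IsPrimitive F f a b) (h : uIcc c d ⊆ uIcc a b) :
    IsPrimitive F f c d :=
  ⟨hF.ac.mono h, hF.ae_hasDerivAt.mono fun _ hx hx' => hx (h hx')⟩

theorem integral_eq (hF : IsPrimitive F f a b) : ∫ x in a..b, f x = F b - F a := by
  rw [← hF.ac.integral_deriv_eq_sub]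
  exact (intervalIntegral.integral_congr_ae hF.deriv_ae_eq).symm

theorem integral_eq_of_mem (hF : IsPrimitive F f a b) {s : ℝ} (hs : s ∈ uIcc a b) :
    ∫ x in a..s, f x = F s - F a :=
  (hF.mono (uIcc_subset_uIcc left_mem_uIcc hs)).integral_eq

theorem congr (hF : IsPrimitive F f a b) (h : EqOn F G (uIcc a b)) : IsPrimitive G f a b := by
  refine ⟨hF.ac.congr_eqOn h, ?_⟩
  -- The endpoints are discarded: the derivative is two-sided, while F and G agree only on the
  -- interval.
  filter_upwards [hF.ae_hasDerivAt, measure_eq_zero_iff_ae_notMem.1 (measure_singleton (μ := volume) a),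
    measure_eq_zero_iff_ae_notMem.1 (measure_singleton (μ := volume) b)] with x hx hxa hxb hx'
  refine (hx hx').congr_of_eventuallyEq ?_
  have : uIcc a b ∈ 𝓝 x := by
    rw [uIcc, mem_Icc] at hx'
    refine Icc_mem_nhds (lt_of_le_of_ne hx'.1 ?_) (lt_of_le_of_ne hx'.2 ?_) <;> grind
  filter_upwards [this] with y hy using (h hy).symm

theorem congr_deriv (hF : IsPrimitive F f a b) (h : EqOn f g (uIcc a b)) :
    IsPrimitive F g a b :=
  ⟨hF.ac, hF.ae_hasDerivAt.mono fun _ hx hx' => h hx' ▸ hx hx'⟩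

theorem of_integral (hf : IntervalIntegrable f volume a b) (C : ℝ) :
    IsPrimitive (fun s => C + ∫ x in a..s, f x) f a b := by
  refine ⟨?_, ?_⟩
  · have h1 : AbsolutelyContinuousOnInterval (fun _ : ℝ => C) a b :=
      (contDiff_const (n := 1)).contDiffOn.absolutelyContinuousOnInterval
    exact h1.add (hf.absolutelyContinuousOnInterval_intervalIntegral left_mem_uIcc)
  · filter_upwards [hf.ae_hasDerivAt_integral] with x hx hx'
    exact (hx hx' a left_mem_uIcc).const_add C

theorem of_hasDerivAt (hf : ContinuousOn f (uIcc a b))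
    (h : ∀ x ∈ uIcc a b, HasDerivAt F (f x) x) : IsPrimitive F f a b := by
  refine ⟨?_, ae_of_all _ h⟩
  obtain ⟨C, hC⟩ := isCompact_uIcc.exists_bound_of_continuousOn hf
  refine LipschitzOnWith.absolutelyContinuousOnInterval (K := C.toNNReal) ?_
  refine (convex_uIcc a b).lipschitzOnWith_of_nnnorm_hasDerivWithin_le
    (fun x hx => (h x hx).hasDerivWithinAt) fun x hx => ?_
  rw [← NNReal.coe_le_coe, coe_nnnorm]
  exact (hC x hx).trans (Real.le_coe_toNNReal C)

theorem sub (hF : IsPrimitive F f a b) (hG : IsPrimitive G g a b) :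
    IsPrimitive (fun x => F x - G x) (fun x => f x - g x) a b := by
  refine ⟨hF.ac.sub hG.ac, ?_⟩
  filter_upwards [hF.ae_hasDerivAt, hG.ae_hasDerivAt] with x h1 h2 hx
  exact (h1 hx).sub (h2 hx)

theorem const_mul (C : ℝ) (hF : IsPrimitive F f a b) :
    IsPrimitive (fun x => C * F x) (fun x => C * f x) a b := by
  refine ⟨hF.ac.const_mul C, ?_⟩
  filter_upwards [hF.ae_hasDerivAt] with x h1 hx
  exact (h1 hx).const_mul C

theorem mul (hF : IsPrimitive F f a b) (hG : IsPrimitive G g a b) :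
    IsPrimitive (fun x => F x * G x) (fun x => f x * G x + F x * g x) a b := by
  refine ⟨hF.ac.fun_mul hG.ac, ?_⟩
  filter_upwards [hF.ae_hasDerivAt, hG.ae_hasDerivAt] with x h1 h2 hx
  exact (h1 hx).mul (h2 hx)

/-- The image of the interval under F is a compact interval, on which the C¹ function H is
Lipschitz, and Lipschitz maps preserve absolute continuity. -/
theorem comp {H H' : ℝ → ℝ} (hF : IsPrimitive F f a b)
    (hH : ∀ x ∈ uIcc a b, ContDiffAt ℝ 1 H (F x))
    (hH' : ∀ x ∈ uIcc a b, HasDerivAt H (H' (F x)) (F x)) :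
    IsPrimitive (fun x => H (F x)) (fun x => H' (F x) * f x) a b := by
  have hS : F '' uIcc a b = uIcc (sInf (F '' uIcc a b)) (sSup (F '' uIcc a b)) :=
    hF.continuousOn.image_uIcc
  have hd : ContDiffOn ℝ 1 H (F '' uIcc a b) := by
    rintro _ ⟨x, hx, rfl⟩
    exact (hH x hx).contDiffWithinAt
  obtain ⟨K, hK⟩ := hd.exists_lipschitzOnWith (by decide) (by rw [hS]; exact convex_uIcc _ _)
    (isCompact_uIcc.image_of_continuousOn hF.continuousOn)
  refine ⟨hF.ac.lipschitzOnWith_comp hK (mapsTo_image _ _), ?_⟩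
  filter_upwards [hF.ae_hasDerivAt] with x h1 hx
  exact (hH' x hx).comp x (h1 hx)

theorem exp (hF : IsPrimitive F f a b) :
    IsPrimitive (fun x => Real.exp (F x)) (fun x => Real.exp (F x) * f x) a b :=
  hF.comp (fun _ _ => Real.contDiff_exp.contDiffAt) fun _ _ => Real.hasDerivAt_exp _

theorem log (hF : IsPrimitive F f a b) (h : ∀ x ∈ uIcc a b, F x ≠ 0) :
    IsPrimitive (fun x => Real.log (F x)) (fun x => (F x)⁻¹ * f x) a b :=
  hF.comp (fun x hx => Real.contDiffAt_log.2 (h x hx)) fun x hx => Real.hasDerivAt_log (h x hx)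

theorem inv (hF : IsPrimitive F f a b) (h : ∀ x ∈ uIcc a b, F x ≠ 0) :
    IsPrimitive (fun x => (F x)⁻¹) (fun x => -(F x ^ 2)⁻¹ * f x) a b :=
  hF.comp (H := fun y => y⁻¹) (H' := fun y => -(y ^ 2)⁻¹)
    (fun x hx => contDiffAt_inv ℝ (h x hx)) fun x hx => hasDerivAt_inv (h x hx)

end IsPrimitive

/-! ### Admissible controls -/

namespace IsAdmissible

variable {z w : Pt} {c : ℝ → ℝ} {γ : ℝ → ℝ × ℝ}

theorem intervalIntegrable (h : IsAdmissible z w c γ) (hzw : z.1 ≤ w.1) :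
    IntervalIntegrable c volume z.1 w.1 := by
  rw [intervalIntegrable_iff_integrableOn_Icc_of_le hzw]
  exact h.memLp.integrable (by norm_num)

theorem intervalIntegrable_sq (h : IsAdmissible z w c γ) (hzw : z.1 ≤ w.1) :
    IntervalIntegrable (fun s => c s ^ 2) volume z.1 w.1 := by
  rw [intervalIntegrable_iff_integrableOn_Icc_of_le hzw]
  exact h.memLp.integrable_sq

theorem continuousOn_fst (h : IsAdmissible z w c γ) :
    ContinuousOn (fun s => (γ s).1) (Icc z.1 w.1) :=
  continuous_fst.comp_continuousOn h.continuousOn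

theorem isPrimitive_fst (h : IsAdmissible z w c γ) (hzw : z.1 ≤ w.1) :
    IsPrimitive (fun s => (γ s).1) (fun s => c s * (γ s).1) z.1 w.1 := by
  have hc := h.continuousOn_fst
  rw [← uIcc_of_le hzw] at hc
  refine (IsPrimitive.of_integral ((h.intervalIntegrable hzw).mul_continuousOn hc) z.2.1).congr ?_
  intro s hs
  rw [uIcc_of_le hzw] at hs
  exact (h.eq_fst s hs).symm

theorem isPrimitive_snd (h : IsAdmissible z w c γ) (hzw : z.1 ≤ w.1) :
    IsPrimitive (fun s => (γ s).2) (fun s => (γ s).1) z.1 w.1 := by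
  have hc := h.continuousOn_fst
  rw [← uIcc_of_le hzw] at hc
  refine (IsPrimitive.of_integral hc.intervalIntegrable z.2.2).congr ?_
  intro s hs
  rw [uIcc_of_le hzw] at hs
  exact (h.eq_snd s hs).symm

theorem initial (h : IsAdmissible z w c γ) (hzw : z.1 ≤ w.1) : γ z.1 = z.2 := by
  have hm : z.1 ∈ Icc z.1 w.1 := left_mem_Icc.2 hzw
  ext
  · simpa using h.eq_fst _ hm
  · simpa using h.eq_snd _ hm

/-- With the integrating factor exp(-∫c), the product with γ₁ has zero derivative almost everywhere.
Positivity of γ₁ follows. -/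
theorem fst_eq_exp (h : IsAdmissible z w c γ) (hzw : z.1 ≤ w.1) {s : ℝ} (hs : s ∈ Icc z.1 w.1) :
    (γ s).1 = z.2.1 * exp (∫ r in z.1..s, c r) := by
  have hq := (IsPrimitive.of_integral (h.intervalIntegrable hzw) 0)
  have he := (hq.const_mul (-1)).exp
  have hp := ((h.isPrimitive_fst hzw).mul he).congr_deriv (g := fun _ => 0) fun s _ => by ring
  have := hp.integral_eq_of_mem (s := s) (by rwa [uIcc_of_le hzw])
  simp only [intervalIntegral.integral_zero, zero_add, intervalIntegral.integral_same, mul_zero,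
    exp_zero, mul_one, h.initial hzw, neg_mul, one_mul, exp_neg] at this
  have := (exp_pos (∫ r in z.1..s, c r)).ne'
  field_simp at *
  linarith

theorem fst_pos (h : IsAdmissible z w c γ) (hzw : z.1 ≤ w.1) (hz : 0 < z.2.1) {s : ℝ}
    (hs : s ∈ Icc z.1 w.1) : 0 < (γ s).1 := by
  rw [h.fst_eq_exp hzw hs]
  positivity

theorem snd_ge (h : IsAdmissible z w c γ) (hzw : z.1 ≤ w.1) (hz : 0 < z.2.1) {s : ℝ}
    (hs : s ∈ Icc z.1 w.1) : z.2.2 ≤ (γ s).2 := by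
  rw [h.eq_snd s hs]
  have := intervalIntegral.integral_nonneg (f := fun r => (γ r).1) (μ := volume) hs.1 fun r hr =>
    (h.fst_pos hzw hz ⟨hr.1, hr.2.trans hs.2⟩).le
  linarith

/-! ### Möbius invariance of the cost and comparison with an extremal -/

section Pole

variable {p : ℝ}

theorem sub_pole_pos (h : IsAdmissible z w c γ) (hzw : z.1 ≤ w.1) (hz : 0 < z.2.1)
    (hp : p < z.2.2) {s : ℝ} (hs : s ∈ Icc z.1 w.1) : 0 < (γ s).2 - p := by
  linarith [h.snd_ge hzw hz hs]

theorem isPrimitive_sub_pole (h : IsAdmissible z w c γ) (hzw : z.1 ≤ w.1) :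
    IsPrimitive (fun s => (γ s).2 - p) (fun s => (γ s).1) z.1 w.1 := by
  refine ((h.isPrimitive_snd hzw).sub (IsPrimitive.of_hasDerivAt (F := fun _ => p)
    (f := fun _ => 0) continuousOn_const fun x _ => hasDerivAt_const _ _)).congr_deriv ?_
  intro s _
  simp

/-- The control of the curve after the Möbius transformation sending `p` to infinity. -/
theorem isPrimitive_log (h : IsAdmissible z w c γ) (hzw : z.1 ≤ w.1) (hz : 0 < z.2.1)
    (hp : p < z.2.2) :
    IsPrimitive (fun s => log (γ s).1 - 2 * log ((γ s).2 - p))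
      (fun s => c s - 2 * ((γ s).1 / ((γ s).2 - p))) z.1 w.1 := by
  refine (((h.isPrimitive_fst hzw).log fun x hx => ?_).sub
    (((h.isPrimitive_sub_pole hzw (p := p)).log fun x hx => ?_).const_mul 2)).congr_deriv ?_
  · rw [uIcc_of_le hzw] at hx
    exact (h.fst_pos hzw hz hx).ne'
  · rw [uIcc_of_le hzw] at hx
    exact (h.sub_pole_pos hzw hz hp hx).ne'
  · intro s hs
    rw [uIcc_of_le hzw] at hs
    have := (h.fst_pos hzw hz hs).ne'
    have := (h.sub_pole_pos hzw hz hp hs).ne'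
    simp only
    field_simp

theorem isPrimitive_inv (h : IsAdmissible z w c γ) (hzw : z.1 ≤ w.1) (hz : 0 < z.2.1)
    (hp : p < z.2.2) :
    IsPrimitive (fun s => ((γ s).2 - p)⁻¹) (fun s => -((γ s).1 / ((γ s).2 - p) ^ 2)) z.1 w.1 := by
  refine ((h.isPrimitive_sub_pole hzw (p := p)).inv fun x hx => ?_).congr_deriv ?_
  · rw [uIcc_of_le hzw] at hx
    exact (h.sub_pole_pos hzw hz hp hx).ne'
  · intro s hs
    simp only
    ring

theorem isPrimitive_div (h : IsAdmissible z w c γ) (hzw : z.1 ≤ w.1) (hz : 0 < z.2.1)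
    (hp : p < z.2.2) :
    IsPrimitive (fun s => (γ s).1 * ((γ s).2 - p)⁻¹)
      (fun s => c s * ((γ s).1 / ((γ s).2 - p)) - ((γ s).1 / ((γ s).2 - p)) ^ 2) z.1 w.1 := by
  refine ((h.isPrimitive_fst hzw).mul (h.isPrimitive_inv hzw hz hp)).congr_deriv ?_
  intro s hs
  simp only [div_eq_mul_inv, ← inv_pow]
  ring

theorem intervalIntegrable_shifted_sq (h : IsAdmissible z w c γ) (hzw : z.1 ≤ w.1)
    (hz : 0 < z.2.1) (hp : p < z.2.2) :
    IntervalIntegrable (fun s => (c s - 2 * ((γ s).1 / ((γ s).2 - p))) ^ 2) volume z.1 w.1 := by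
  convert! (h.intervalIntegrable_sq hzw).sub
    ((h.isPrimitive_div hzw hz hp).intervalIntegrable.const_mul 4) using 2 with s
  ring

/-- With q = γ₁/(γ₂-p) one has q' = cq - q², hence (c - 2q)² = c² - 4q' and the cost changes by
endpoint values only. -/
theorem integral_shifted_sq (h : IsAdmissible z w c γ) (hzw : z.1 ≤ w.1)
    (hz : 0 < z.2.1) (hp : p < z.2.2) :
    ∫ s in z.1..w.1, (c s - 2 * ((γ s).1 / ((γ s).2 - p))) ^ 2 =
      cost z w c - 4 * (w.2.1 * (w.2.2 - p)⁻¹ - z.2.1 * (z.2.2 - p)⁻¹) := by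
  have h1 := (h.isPrimitive_div hzw hz hp)
  have h2 := h1.integral_eq
  rw [h.terminal, h.initial hzw] at h2
  rw [← h2, cost, ← intervalIntegral.integral_const_mul, ← intervalIntegral.integral_sub]
  · congr 1 with s
    rw [sq_abs]
    ring
  · simpa only [sq_abs] using h.intervalIntegrable_sq hzw
  · exact h1.intervalIntegrable.const_mul 4

variable {c₀ : ℝ → ℝ} {γ₀ : ℝ → ℝ × ℝ} {k : ℝ} {b : ℝ → ℝ}

theorem intervalIntegrable_sub_sq (h : IsAdmissible z w c γ) (h₀ : IsAdmissible z w c₀ γ₀)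
    (hzw : z.1 ≤ w.1) (hz : 0 < z.2.1) (hp : p < z.2.2)
    (hb : ∀ s ∈ Icc z.1 w.1, c₀ s - 2 * ((γ₀ s).1 / ((γ₀ s).2 - p)) = b s)
    (hb' : ContinuousOn b (Icc z.1 w.1)) :
    IntervalIntegrable (fun s => (c s - 2 * ((γ s).1 / ((γ s).2 - p)) -
      (c₀ s - 2 * ((γ₀ s).1 / ((γ₀ s).2 - p)))) ^ 2) volume z.1 w.1 := by
  have hu := uIcc_of_le hzw
  have hr := (h.isPrimitive_log hzw hz hp).sub (h₀.isPrimitive_log hzw hz hp)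
  have i1 := h.intervalIntegrable_shifted_sq hzw hz hp
  have i2 := h₀.intervalIntegrable_shifted_sq hzw hz hp
  -- Write a for the shifted control of γ. Then (a - b)² = a² - b² - 2b(a - b), where the last
  -- product has a continuous factor.
  refine ((i1.sub i2).sub ((hr.intervalIntegrable.continuousOn_mul
    (hu ▸ hb')).const_mul 2)).congr fun s hs => ?_
  have hs := uIoc_subset_uIcc hs
  rw [hu] at hs
  simp only [← hb s hs]
  ring

/-- Let a, b be the shifted controls and X, Y the values of γ₁/(γ₂-p)² for γ and γ₀. Then a² - b² =
(a-b)² + 2b(a-b), and a - b is the derivative of log(X/Y), which vanishes at both ends. Integration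
by parts gives ∫b(a-b) = -∫kY log(X/Y). Finally Y log(X/Y) ≤ X - Y, and X - Y has zero integral
because both curves have the same endpoints. The sign of k makes the inequality point the right way.
-/
theorem cost_add_integral_sq_le (h : IsAdmissible z w c γ) (h₀ : IsAdmissible z w c₀ γ₀)
    (hzw : z.1 ≤ w.1) (hz : 0 < z.2.1) (hp : p < z.2.2) (hk : 0 ≤ k)
    (hb : ∀ s ∈ Icc z.1 w.1, c₀ s - 2 * ((γ₀ s).1 / ((γ₀ s).2 - p)) = b s)
    (hb' : ∀ s ∈ Icc z.1 w.1, HasDerivAt b (k * ((γ₀ s).1 / ((γ₀ s).2 - p) ^ 2)) s) :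
    cost z w c₀ + ∫ s in z.1..w.1, (c s - 2 * ((γ s).1 / ((γ s).2 - p)) -
      (c₀ s - 2 * ((γ₀ s).1 / ((γ₀ s).2 - p)))) ^ 2 ≤ cost z w c := by
  have hu := uIcc_of_le hzw
  have hr := (h.isPrimitive_log hzw hz hp).sub (h₀.isPrimitive_log hzw hz hp)
  have hI := ((h₀.isPrimitive_inv hzw hz hp).sub (h.isPrimitive_inv hzw hz hp)).const_mul k
  have hbp : IsPrimitive b (fun s => k * ((γ₀ s).1 / ((γ₀ s).2 - p) ^ 2)) z.1 w.1 := by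
    refine IsPrimitive.of_hasDerivAt ?_ (by rwa [hu])
    have h1 := (h₀.isPrimitive_fst hzw).continuousOn
    have h2 := (h₀.isPrimitive_sub_pole hzw (p := p)).continuousOn
    refine continuousOn_const.mul (h1.div (h2.pow 2) fun s hs => ?_)
    rw [hu] at hs
    exact (pow_pos (h₀.sub_pole_pos hzw hz hp hs) 2).ne'
  have hbr := hbp.mul hr
  have e1 := h.integral_shifted_sq hzw hz hp
  have e2 := h₀.integral_shifted_sq hzw hz hp
  have i1 := h.intervalIntegrable_shifted_sq hzw hz hp
  have i2 := h₀.intervalIntegrable_shifted_sq hzw hz hp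
  have i3 : IntervalIntegrable (fun s => b s * ((c s - 2 * ((γ s).1 / ((γ s).2 - p))) -
      (c₀ s - 2 * ((γ₀ s).1 / ((γ₀ s).2 - p))))) volume z.1 w.1 :=
    hr.intervalIntegrable.continuousOn_mul hbp.continuousOn
  have e3 : ∫ s in z.1..w.1, (c s - 2 * ((γ s).1 / ((γ s).2 - p)) -
      (c₀ s - 2 * ((γ₀ s).1 / ((γ₀ s).2 - p)))) ^ 2 =
      (∫ s in z.1..w.1, (c s - 2 * ((γ s).1 / ((γ s).2 - p))) ^ 2) -
      (∫ s in z.1..w.1, (c₀ s - 2 * ((γ₀ s).1 / ((γ₀ s).2 - p))) ^ 2) -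
      2 * ∫ s in z.1..w.1, b s * ((c s - 2 * ((γ s).1 / ((γ s).2 - p))) -
        (c₀ s - 2 * ((γ₀ s).1 / ((γ₀ s).2 - p)))) := by
    rw [← intervalIntegral.integral_const_mul, ← intervalIntegral.integral_sub i1 i2,
      ← intervalIntegral.integral_sub (i1.sub i2) (i3.const_mul 2)]
    refine intervalIntegral.integral_congr fun s hs => ?_
    rw [hu] at hs
    simp only [← hb s hs]
    ring
  have e4 := hbr.integral_eq
  rw [intervalIntegral.integral_add
    (hbp.intervalIntegrable.mul_continuousOn hr.continuousOn) i3] at e4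
  simp only [h.terminal, h₀.terminal, h.initial hzw, h₀.initial hzw, sub_self, mul_zero] at e4
  have e5 := hI.integral_eq
  simp only [h.terminal, h₀.terminal, h.initial hzw, h₀.initial hzw, sub_self, mul_zero] at e5
  have e6 : ∫ s in z.1..w.1, k * ((γ₀ s).1 / ((γ₀ s).2 - p) ^ 2) *
      (log (γ s).1 - 2 * log ((γ s).2 - p) - (log (γ₀ s).1 - 2 * log ((γ₀ s).2 - p))) ≤ 0 := by
    rw [← e5]
    refine intervalIntegral.integral_mono_on hzw
      (hbp.intervalIntegrable.mul_continuousOn hr.continuousOn) hI.intervalIntegrable fun s hs => ?_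
    rw [mul_assoc]
    refine mul_le_mul_of_nonneg_left ?_ hk
    have p1 := h.fst_pos hzw hz hs
    have p2 := h₀.fst_pos hzw hz hs
    have p3 := h.sub_pole_pos hzw hz hp hs
    have p4 := h₀.sub_pole_pos hzw hz hp hs
    have q1 : ∀ x y : ℝ, 0 < x → 0 < y → log x - 2 * log y = log (x / y ^ 2) := by
      intro x y hx hy
      rw [Real.log_div hx.ne' (by positivity), Real.log_pow]
      norm_num
    rw [q1 _ _ p1 p3, q1 _ _ p2 p4]
    have p5 : 0 < (γ s).1 / ((γ s).2 - p) ^ 2 := by positivity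
    have p6 : 0 < (γ₀ s).1 / ((γ₀ s).2 - p) ^ 2 := by positivity
    generalize (γ s).1 / ((γ s).2 - p) ^ 2 = x at *
    generalize (γ₀ s).1 / ((γ₀ s).2 - p) ^ 2 = y at *
    rw [← Real.log_div p5.ne' p6.ne']
    have := Real.log_le_sub_one_of_pos (div_pos p5 p6)
    calc y * log (x / y) ≤ y * (x / y - 1) := by gcongr
      _ = _ := by field_simp; ring
  linarith

/-- No excess cost forces the shifted controls to agree almost everywhere, hence X = Y in the
notation of the comparison above. These are, up to sign, the derivatives of 1/(γ₂-p), so the second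
components agree, and then the first ones. -/
theorem eqOn_of_cost_le (h : IsAdmissible z w c γ) (h₀ : IsAdmissible z w c₀ γ₀)
    (hzw : z.1 ≤ w.1) (hz : 0 < z.2.1) (hp : p < z.2.2) (hk : 0 ≤ k)
    (hb : ∀ s ∈ Icc z.1 w.1, c₀ s - 2 * ((γ₀ s).1 / ((γ₀ s).2 - p)) = b s)
    (hb' : ∀ s ∈ Icc z.1 w.1, HasDerivAt b (k * ((γ₀ s).1 / ((γ₀ s).2 - p) ^ 2)) s)
    (hc : cost z w c ≤ cost z w c₀) : EqOn γ γ₀ (Icc z.1 w.1) := by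
  have hle := h.cost_add_integral_sq_le h₀ hzw hz hp hk hb hb'
  have hr := (h.isPrimitive_log hzw hz hp).sub (h₀.isPrimitive_log hzw hz hp)
  have hu := uIcc_of_le hzw
  have hint := h.intervalIntegrable_sub_sq h₀ hzw hz hp hb
    fun s hs => (hb' s hs).continuousAt.continuousWithinAt
  have h0 := intervalIntegral.integral_nonneg_of_forall (μ := volume) hzw
    (fun s => sq_nonneg (c s - 2 * ((γ s).1 / ((γ s).2 - p)) -
      (c₀ s - 2 * ((γ₀ s).1 / ((γ₀ s).2 - p)))))
  have h1 := (intervalIntegral.integral_eq_zero_iff_of_le_of_nonneg_ae hzw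
    (ae_of_all _ fun s => sq_nonneg _) hint).1 (by linarith)
  have hr0 : ∀ s ∈ Icc z.1 w.1, log (γ s).1 - 2 * log ((γ s).2 - p) =
      log (γ₀ s).1 - 2 * log ((γ₀ s).2 - p) := by
    intro s hs
    have h2 := hr.integral_eq_of_mem (s := s) (by rwa [hu])
    rw [h.initial hzw, h₀.initial hzw, intervalIntegral.integral_of_le hs.1,
      integral_eq_zero_of_ae] at h2
    · linarith
    · filter_upwards [ae_restrict_of_ae_restrict_of_subset (Ioc_subset_Ioc_right hs.2) h1]
        with x hx
      exact pow_eq_zero_iff (two_ne_zero) |>.1 hx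
  have hr1 : ∀ s ∈ Icc z.1 w.1, (γ s).1 / ((γ s).2 - p) ^ 2 =
      (γ₀ s).1 / ((γ₀ s).2 - p) ^ 2 := by
    intro s hs
    have p1 := h.fst_pos hzw hz hs
    have p2 := h₀.fst_pos hzw hz hs
    have p3 := h.sub_pole_pos hzw hz hp hs
    have p4 := h₀.sub_pole_pos hzw hz hp hs
    have q1 : ∀ x y : ℝ, 0 < x → 0 < y → log x - 2 * log y = log (x / y ^ 2) := by
      intro x y hx hy
      rw [Real.log_div hx.ne' (by positivity), Real.log_pow]
      norm_num
    have := hr0 s hs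
    rw [q1 _ _ p1 p3, q1 _ _ p2 p4] at this
    exact Real.log_injOn_pos (mem_Ioi.2 (by positivity)) (mem_Ioi.2 (by positivity)) this
  intro s hs
  have hI := ((h₀.isPrimitive_inv hzw hz hp).sub (h.isPrimitive_inv hzw hz hp)).congr_deriv
    (g := fun _ => 0) fun s hs => by
      rw [hu] at hs
      simp only [hr1 s hs, sub_self]
  have h3 := hI.integral_eq_of_mem (s := s) (by rwa [hu])
  simp only [intervalIntegral.integral_zero, h.initial hzw, h₀.initial hzw, sub_self, sub_zero]
    at h3
  have h4 : (γ s).2 = (γ₀ s).2 := by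
    have := inv_injective (sub_eq_zero.1 h3.symm)
    linarith
  have h5 := hr1 s hs
  rw [h4, div_left_inj' (pow_pos (h₀.sub_pole_pos hzw hz hp hs) 2).ne'] at h5
  exact Prod.ext h5 h4

end Pole

end IsAdmissible

/-! ### Solutions of `φ'' = E φ` -/

/-- The solution of `φ'' = E φ` with `φ(0) = 0`, `φ'(0) = 1`. -/
noncomputable def sinE (E u : ℝ) : ℝ := u * gFun (E * u ^ 2)

/-- The solution of `φ'' = E φ` with `φ(0) = 1`, `φ'(0) = 0`. -/
noncomputable def cosE (E u : ℝ) : ℝ := coshSqrt (E * u ^ 2)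

section Oscillator

variable (E : ℝ)

theorem hasDerivAt_sinE (u : ℝ) : HasDerivAt (sinE E) (cosE E u) u := by
  have h := (hasDerivAt_id u).mul
    ((hasDerivAt_gFun (E * u ^ 2)).comp u (((hasDerivAt_id u).pow 2).const_mul E))
  convert! h using 1
  simp [cosE, coshSqrt]
  ring

theorem hasDerivAt_cosE (u : ℝ) : HasDerivAt (cosE E) (E * sinE E u) u := by
  have h := (hasDerivAt_coshSqrt (E * u ^ 2)).comp u (((hasDerivAt_id u).pow 2).const_mul E)
  convert! h using 1
  simp [sinE]
  ring

@[simp] theorem sinE_zero : sinE E 0 = 0 := by simp [sinE]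

@[simp] theorem cosE_zero : cosE E 0 = 1 := by simp [cosE, coshSqrt_zero]

@[simp] theorem sinE_neg (u : ℝ) : sinE E (-u) = -sinE E u := by simp [sinE]

@[simp] theorem cosE_neg (u : ℝ) : cosE E (-u) = cosE E u := by simp [cosE]

theorem cosE_sq (u : ℝ) : cosE E u ^ 2 = 1 + E * sinE E u ^ 2 := by
  rw [cosE, sinE, coshSqrt_sq]
  ring

theorem sinE_add (u v : ℝ) : sinE E (u + v) = sinE E u * cosE E v + cosE E u * sinE E v := by
  -- The sum u + v is held fixed and x moves weight from one argument to the other; the expression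
  -- is constant, and x = 0 and x = v give the two sides.
  have hd : ∀ x, HasDerivAt
      (fun x => sinE E (u + v - x) * cosE E x + cosE E (u + v - x) * sinE E x) 0 x := by
    intro x
    have h0 : HasDerivAt (fun x => u + v - x) (-1) x := (hasDerivAt_id x).const_sub _
    have h := (((hasDerivAt_sinE E (u + v - x)).comp x h0).mul (hasDerivAt_cosE E x)).add
      (((hasDerivAt_cosE E (u + v - x)).comp x h0).mul (hasDerivAt_sinE E x))
    convert! h using 1
    simp only [Function.comp]
    ring
  have := is_const_of_deriv_eq_zero (fun x => (hd x).differentiableAt) (fun x => (hd x).deriv) 0 v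
  simpa using this

theorem cosE_add (u v : ℝ) :
    cosE E (u + v) = cosE E u * cosE E v + E * (sinE E u * sinE E v) := by
  have hd : ∀ x, HasDerivAt
      (fun x => cosE E (u + v - x) * cosE E x + E * (sinE E (u + v - x) * sinE E x)) 0 x := by
    intro x
    have h0 : HasDerivAt (fun x => u + v - x) (-1) x := (hasDerivAt_id x).const_sub _
    have h := (((hasDerivAt_cosE E (u + v - x)).comp x h0).mul (hasDerivAt_cosE E x)).add
      ((((hasDerivAt_sinE E (u + v - x)).comp x h0).mul (hasDerivAt_sinE E x)).const_mul E)
    convert! h using 1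
    simp only [Function.comp]
    ring
  have := is_const_of_deriv_eq_zero (fun x => (hd x).differentiableAt) (fun x => (hd x).deriv) 0 v
  simpa using this

variable {E}

theorem sinE_pos {u : ℝ} (hu : 0 < u) (h : -π ^ 2 < E * u ^ 2) : 0 < sinE E u :=
  mul_pos hu (gFun_pos h)

theorem neg_pi_sq_lt_of_le {u v : ℝ} (hu : 0 ≤ u) (huv : u ≤ v) (h : -π ^ 2 < E * v ^ 2) :
    -π ^ 2 < E * u ^ 2 := by
  have h1 : u ^ 2 ≤ v ^ 2 := by gcongr
  rcases le_or_gt 0 E with hE | hE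
  · nlinarith [pi_pos, mul_nonneg hE (sq_nonneg u), pow_pos pi_pos 2]
  · nlinarith

/-- The solution of `φ'' = E φ` with `φ(0) = a`, `φ'(0) = b`. -/
noncomputable def phiE (E a b u : ℝ) : ℝ := a * cosE E u + b * sinE E u

/-- The derivative of `phiE`. -/
noncomputable def phiE' (E a b u : ℝ) : ℝ := a * (E * sinE E u) + b * cosE E u

variable (E) (a b : ℝ)

theorem hasDerivAt_phiE (u : ℝ) : HasDerivAt (phiE E a b) (phiE' E a b u) u :=
  ((hasDerivAt_cosE E u).const_mul a).add ((hasDerivAt_sinE E u).const_mul b)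

theorem hasDerivAt_phiE' (u : ℝ) : HasDerivAt (phiE' E a b) (E * phiE E a b u) u := by
  have h := (((hasDerivAt_sinE E u).const_mul E).const_mul a).add
    ((hasDerivAt_cosE E u).const_mul b)
  convert! h using 1
  rw [phiE]
  ring

theorem continuous_phiE : Continuous (phiE E a b) :=
  continuous_iff_continuousAt.2 fun u => (hasDerivAt_phiE E a b u).continuousAt

theorem continuous_phiE' : Continuous (phiE' E a b) :=
  continuous_iff_continuousAt.2 fun u => (hasDerivAt_phiE' E a b u).continuousAt

@[simp] theorem phiE_zero : phiE E a b 0 = a := by simp [phiE]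

@[simp] theorem phiE'_zero : phiE' E a b 0 = b := by simp [phiE']

theorem phiE_add (u d : ℝ) :
    phiE E a b (u + d) = phiE E a b u * cosE E d + phiE' E a b u * sinE E d := by
  rw [phiE, phiE, phiE', sinE_add, cosE_add]
  ring

/-- As a function of u this solves φ'' = Eφ and vanishes at u = v. It yields both positivity of φ
and the increments of γ₂. -/
theorem sinE_mul_phiE_sub (u v : ℝ) :
    sinE E u * phiE E a b v - sinE E v * phiE E a b u = a * sinE E (u - v) := by
  rw [phiE, phiE, sub_eq_add_neg u v, sinE_add, sinE_neg, cosE_neg]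
  ring

theorem sinE_deriv_mul_phiE_sub (u : ℝ) :
    cosE E u * phiE E a b u - sinE E u * phiE' E a b u = a := by
  rw [phiE, phiE']
  linear_combination a * cosE_sq E u

end Oscillator

/-! ### The extremal curve -/

/-- The time to maturity `T - t`. -/
noncomputable abbrev tau (z w : Pt) : ℝ := w.1 - z.1

/-- The reduced energy `g⁻¹(1 / h(z; w))`. -/
noncomputable def rho (z w : Pt) : ℝ := gInv (1 / hFun z w)

/-- The energy of the optimal curve. -/
noncomputable def energy (z w : Pt) : ℝ := rho z w / tau z w ^ 2

/-- The slope at the initial time of `γ₁ ^ (-1 / 2)`, for the optimal curve `γ`. -/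
noncomputable def slope₀ (z w : Pt) : ℝ :=
  ((√w.2.1)⁻¹ - (√z.2.1)⁻¹ * cosE (energy z w) (tau z w)) / sinE (energy z w) (tau z w)

/-- The function `γ₁ ^ (-1 / 2)`, for the optimal curve `γ`, as a function of time since `t`. -/
noncomputable def extPhi (z w : Pt) : ℝ → ℝ := phiE (energy z w) (√z.2.1)⁻¹ (slope₀ z w)

/-- The derivative of `extPhi`. -/
noncomputable def extPhi' (z w : Pt) : ℝ → ℝ := phiE' (energy z w) (√z.2.1)⁻¹ (slope₀ z w)

/-- The explicit optimal curve. -/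
noncomputable def extremal (z w : Pt) (s : ℝ) : ℝ × ℝ :=
  ((extPhi z w (s - z.1) ^ 2)⁻¹,
    z.2.2 + sinE (energy z w) (s - z.1) * √z.2.1 / extPhi z w (s - z.1))

/-- The explicit optimal control. -/
noncomputable def extControl (z w : Pt) (s : ℝ) : ℝ :=
  -2 * (extPhi' z w (s - z.1) / extPhi z w (s - z.1))

namespace Prec

variable {z w : Pt} (hzw : Prec z w)

include hzw

theorem tau_pos : 0 < tau z w := sub_pos.2 hzw.2.2.1

theorem hFun_pos : 0 < hFun z w :=
  div_pos (mul_pos hzw.tau_pos (Real.sqrt_pos.2 (mul_pos hzw.1 hzw.2.1))) (sub_pos.2 hzw.2.2.2)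

theorem rho_gt : -π ^ 2 < rho z w := gInv_gt (one_div_pos.2 hzw.hFun_pos)

theorem gFun_rho : gFun (rho z w) = 1 / hFun z w := gFun_gInv (one_div_pos.2 hzw.hFun_pos)

theorem energy_mul_sq : energy z w * tau z w ^ 2 = rho z w :=
  div_mul_cancel₀ _ (pow_pos hzw.tau_pos 2).ne'

theorem energy_gt {u : ℝ} (h0 : 0 ≤ u) (hu : u ≤ tau z w) : -π ^ 2 < energy z w * u ^ 2 :=
  neg_pi_sq_lt_of_le h0 hu (by rw [hzw.energy_mul_sq]; exact hzw.rho_gt)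

theorem sinE_tau : sinE (energy z w) (tau z w) = (w.2.2 - z.2.2) / (√z.2.1 * √w.2.1) := by
  have := hzw.tau_pos.ne'
  have := (sub_pos.2 hzw.2.2.2).ne'
  rw [sinE, hzw.energy_mul_sq, hzw.gFun_rho, hFun, Real.sqrt_mul hzw.1.le]
  field_simp

theorem sinE_tau_pos : 0 < sinE (energy z w) (tau z w) :=
  sinE_pos hzw.tau_pos (hzw.energy_gt hzw.tau_pos.le le_rfl)

theorem extPhi_tau : extPhi z w (tau z w) = (√w.2.1)⁻¹ := by
  have := hzw.sinE_tau_pos.ne'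
  rw [extPhi, phiE, slope₀]
  field_simp
  ring

/-- Here `sinE`(τ) φ(u) = `sinE`(u)/√y₁ + `sinE`(τ-u)/√x₁, a sum of a positive and a nonnegative
term when u > 0. -/
theorem extPhi_pos {u : ℝ} (h0 : 0 ≤ u) (hu : u ≤ tau z w) : 0 < extPhi z w u := by
  have hx := inv_pos.2 (Real.sqrt_pos.2 hzw.1)
  have hy := inv_pos.2 (Real.sqrt_pos.2 hzw.2.1)
  rcases h0.eq_or_lt with rfl | h0
  · rw [extPhi, phiE_zero]
    exact hx
  have h := sinE_mul_phiE_sub (energy z w) (√z.2.1)⁻¹ (slope₀ z w) (tau z w) u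
  rw [← extPhi, hzw.extPhi_tau] at h
  have h1 : 0 < sinE (energy z w) u := sinE_pos h0 (hzw.energy_gt h0.le hu)
  have h2 : 0 ≤ sinE (energy z w) (tau z w - u) := by
    rcases hu.eq_or_lt with rfl | hu
    · simp
    · exact (sinE_pos (sub_pos.2 hu) (hzw.energy_gt (sub_nonneg.2 hu.le) (by linarith))).le
  have h3 : 0 < sinE (energy z w) (tau z w) * extPhi z w u := by
    have := mul_pos h1 hy
    have := mul_nonneg hx.le h2
    linarith
  exact (mul_pos_iff_of_pos_left hzw.sinE_tau_pos).1 h3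

theorem extPhi_pos_of_mem {s : ℝ} (hs : s ∈ Icc z.1 w.1) : 0 < extPhi z w (s - z.1) :=
  hzw.extPhi_pos (by linarith [hs.1]) (by linarith [hs.2])

theorem extremal_snd_sub {s r : ℝ} (hs : extPhi z w (s - z.1) ≠ 0)
    (hr : extPhi z w (r - z.1) ≠ 0) : (extremal z w s).2 - (extremal z w r).2 =
      sinE (energy z w) (s - r) / (extPhi z w (r - z.1) * extPhi z w (s - z.1)) := by
  have h := sinE_mul_phiE_sub (energy z w) (√z.2.1)⁻¹ (slope₀ z w) (s - z.1) (r - z.1)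
  have hx := (Real.sqrt_pos.2 hzw.1).ne'
  rw [← extPhi, show s - z.1 - (r - z.1) = s - r by ring] at h
  simp only [extremal]
  field_simp at h ⊢
  linear_combination h

theorem extremal_initial : extremal z w z.1 = z.2 := by
  simp [extremal, extPhi, Real.sq_sqrt hzw.1.le]

theorem extremal_terminal : extremal z w w.1 = w.2 := by
  have h1 := Real.sqrt_pos.2 hzw.1
  have h2 := Real.sqrt_pos.2 hzw.2.1
  have h := hzw.extPhi_tau
  have h' := hzw.sinE_tau
  rw [tau] at h h'
  refine Prod.ext ?_ ?_
  · simp [extremal, h, Real.sq_sqrt hzw.2.1.le]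
  · simp only [extremal, h, h']
    field_simp
    ring

theorem hasDerivAt_extremal_fst {s : ℝ} (hs : s ∈ Icc z.1 w.1) :
    HasDerivAt (fun s => (extremal z w s).1) (extControl z w s * (extremal z w s).1) s := by
  have hp := (hzw.extPhi_pos_of_mem hs).ne'
  have h := (((hasDerivAt_phiE (energy z w) (√z.2.1)⁻¹ (slope₀ z w) (s - z.1)).comp_sub_const
    s z.1).pow 2).inv (pow_ne_zero 2 hp)
  convert! h using 1
  simp only [Pi.pow_apply]
  rw [← extPhi, ← extPhi', extControl, extremal]
  field_simp
  norm_num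
  exact Or.inl (mul_comm _ _)

theorem hasDerivAt_extremal_snd {s : ℝ} (hs : s ∈ Icc z.1 w.1) :
    HasDerivAt (fun s => (extremal z w s).2) (extremal z w s).1 s := by
  have hp := (hzw.extPhi_pos_of_mem hs).ne'
  have hx := (Real.sqrt_pos.2 hzw.1).ne'
  have h := (((((hasDerivAt_sinE (energy z w) (s - z.1)).comp_sub_const s z.1).mul_const
    (√z.2.1)).div ((hasDerivAt_phiE (energy z w) (√z.2.1)⁻¹ (slope₀ z w) (s - z.1)).comp_sub_const
    s z.1)) hp).const_add z.2.2
  convert! h using 1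
  -- The Wronskian of `sinE` and φ is φ(0) = 1/√x₁, so the quotient has derivative φ⁻² = γ₁.
  have h2 := sinE_deriv_mul_phiE_sub (energy z w) (√z.2.1)⁻¹ (slope₀ z w) (s - z.1)
  rw [← extPhi, ← extPhi'] at *
  rw [extremal]
  field_simp at h2 ⊢
  linear_combination -h2

omit hzw in
theorem continuousOn_extPhi : ContinuousOn (fun s => extPhi z w (s - z.1)) (Icc z.1 w.1) :=
  ((continuous_phiE _ _ _).comp (continuous_id.sub continuous_const)).continuousOn

theorem continuousOn_extControl : ContinuousOn (extControl z w) (Icc z.1 w.1) :=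
  continuousOn_const.mul
    (((continuous_phiE' _ _ _).comp (continuous_id.sub continuous_const)).continuousOn.div
      continuousOn_extPhi fun _ hs => (hzw.extPhi_pos_of_mem hs).ne')

theorem isAdmissible_extremal : IsAdmissible z w (extControl z w) (extremal z w) := by
  have hle := hzw.2.2.1.le
  have hc1 : ContinuousOn (fun s => (extremal z w s).1) (Icc z.1 w.1) := fun s hs =>
    (hzw.hasDerivAt_extremal_fst hs).continuousAt.continuousWithinAt
  have hc2 : ContinuousOn (fun s => (extremal z w s).2) (Icc z.1 w.1) := fun s hs =>
    (hzw.hasDerivAt_extremal_snd hs).continuousAt.continuousWithinAt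
  refine ⟨?_, hc1.prodMk hc2, fun s hs => ?_, fun s hs => ?_, hzw.extremal_terminal⟩
  · obtain ⟨C, hC⟩ := isCompact_Icc.exists_bound_of_continuousOn hzw.continuousOn_extControl
    exact MemLp.of_bound (hzw.continuousOn_extControl.aestronglyMeasurable measurableSet_Icc) C
      ((ae_restrict_iff' measurableSet_Icc).2 (ae_of_all _ hC))
  · have hs' : uIcc z.1 s ⊆ Icc z.1 w.1 := by
      rw [uIcc_of_le hs.1]
      exact Icc_subset_Icc_right hs.2
    rw [intervalIntegral.integral_eq_sub_of_hasDerivAt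
      (fun r hr => hzw.hasDerivAt_extremal_fst (hs' hr))
      ((hzw.continuousOn_extControl.mul hc1).mono hs').intervalIntegrable, hzw.extremal_initial]
    ring
  · have hs' : uIcc z.1 s ⊆ Icc z.1 w.1 := by
      rw [uIcc_of_le hs.1]
      exact Icc_subset_Icc_right hs.2
    rw [intervalIntegral.integral_eq_sub_of_hasDerivAt
      (fun r hr => hzw.hasDerivAt_extremal_snd (hs' hr))
      (hc1.mono hs').intervalIntegrable, hzw.extremal_initial]
    ring

/-- The extremal curve extends slightly to the past of `t`. -/
theorem exists_past : ∃ s₀ < z.1, 0 < extPhi z w (s₀ - z.1) ∧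
    -π ^ 2 < energy z w * (w.1 - s₀) ^ 2 := by
  have h1 : ∀ᶠ s₀ in 𝓝 z.1, 0 < extPhi z w (s₀ - z.1) := by
    have : ContinuousAt (fun s => extPhi z w (s - z.1)) z.1 :=
      ((continuous_phiE _ _ _).comp (continuous_id.sub continuous_const)).continuousAt
    exact this.eventually (lt_mem_nhds (hzw.extPhi_pos_of_mem (left_mem_Icc.2 hzw.2.2.1.le)))
  have h2 : ∀ᶠ s₀ in 𝓝 z.1, -π ^ 2 < energy z w * (w.1 - s₀) ^ 2 := by
    have : ContinuousAt (fun s => energy z w * (w.1 - s) ^ 2) z.1 := by fun_prop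
    exact this.eventually (lt_mem_nhds (hzw.energy_gt hzw.tau_pos.le le_rfl))
  obtain ⟨s₀, h3, h4⟩ := ((h1.and h2).filter_mono nhdsWithin_le_nhds).and
    (self_mem_nhdsWithin (a := z.1) (s := Iio z.1)) |>.exists
  exact ⟨s₀, h4, h3⟩

/-- A pole and a time for which the comparison theorem applies to the extremal curve. -/
theorem exists_pole : ∃ p < z.2.2, ∃ k ≥ 0, ∃ b : ℝ → ℝ,
    (∀ s ∈ Icc z.1 w.1,
      extControl z w s - 2 * ((extremal z w s).1 / ((extremal z w s).2 - p)) = b s) ∧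
    ∀ s ∈ Icc z.1 w.1,
      HasDerivAt b (k * ((extremal z w s).1 / ((extremal z w s).2 - p) ^ 2)) s := by
  obtain ⟨s₀, hs₀, hφ, hE⟩ := hzw.exists_past
  have hS : ∀ s ∈ Icc z.1 w.1, 0 < sinE (energy z w) (s - s₀) := fun s hs =>
    sinE_pos (by linarith [hs.1]) (neg_pi_sq_lt_of_le (by linarith [hs.1])
      (by linarith [hs.2]) hE)
  have hm := left_mem_Icc.2 hzw.2.2.1.le
  have hsub := fun s hs => hzw.extremal_snd_sub (hzw.extPhi_pos_of_mem (s := s) hs).ne' hφ.ne'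
  -- The pole is the position of the extremal at s₀ < t. Shifting the control by it leaves -2 times
  -- the logarithmic derivative of `sinE`(s - s₀), with derivative 2/`sinE`², and k = 2/φ(s₀)²
  -- matches this with k γ₁/(γ₂-p)².
  refine ⟨(extremal z w s₀).2, ?_, 2 / extPhi z w (s₀ - z.1) ^ 2, by positivity,
    fun s => -2 * (cosE (energy z w) (s - s₀) / sinE (energy z w) (s - s₀)), ?_, ?_⟩
  · have h1 := hsub z.1 hm
    rw [hzw.extremal_initial] at h1
    have h2 := div_pos (hS _ hm) (mul_pos hφ (hzw.extPhi_pos_of_mem hm))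
    linarith
  · intro s hs
    have hp := (hzw.extPhi_pos_of_mem hs).ne'
    have hq := (hS s hs).ne'
    have h := phiE_add (energy z w) (√z.2.1)⁻¹ (slope₀ z w) (s - z.1) (-(s - s₀))
    rw [← extPhi, ← extPhi', show s - z.1 + -(s - s₀) = s₀ - z.1 by ring, cosE_neg, sinE_neg] at h
    rw [hsub s hs, extControl, extremal]
    field_simp
    linear_combination -h
  · intro s hs
    have hp := (hzw.extPhi_pos_of_mem hs).ne'
    have hq := (hS s hs).ne'
    have h := ((((hasDerivAt_cosE (energy z w) (s - s₀)).comp_sub_const s s₀).div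
      ((hasDerivAt_sinE (energy z w) (s - s₀)).comp_sub_const s s₀) hq).const_mul (-2))
    convert! h using 1
    have h2 := cosE_sq (energy z w) (s - s₀)
    rw [hsub s hs, extremal]
    field_simp
    linear_combination -h2

theorem isOptimal_extremal : IsOptimal z w (extControl z w) (extremal z w) := by
  refine ⟨hzw.isAdmissible_extremal, fun c γ h => ?_⟩
  obtain ⟨p, hp, k, hk, b, hb, hb'⟩ := hzw.exists_pole
  have h1 := h.cost_add_integral_sq_le hzw.isAdmissible_extremal hzw.2.2.1.le hzw.1 hp hk hb hb'
  refine le_trans (le_add_of_nonneg_right ?_) h1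
  exact intervalIntegral.integral_nonneg_of_forall hzw.2.2.1.le fun s => sq_nonneg _

theorem eqOn_extremal {γ : ℝ → ℝ × ℝ} (h : IsOptimalCurve z w γ) :
    EqOn γ (extremal z w) (Icc z.1 w.1) := by
  obtain ⟨c, h, hc⟩ := h
  obtain ⟨p, hp, k, hk, b, hb, hb'⟩ := hzw.exists_pole
  exact h.eqOn_of_cost_le hzw.isAdmissible_extremal hzw.2.2.1.le hzw.1 hp hk hb hb'
    (hc _ _ hzw.isAdmissible_extremal)

theorem isOptimalCurve_extremal : IsOptimalCurve z w (extremal z w) :=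
  ⟨_, hzw.isOptimal_extremal⟩

theorem eqOn_optimalCurve : EqOn (optimalCurve z w) (extremal z w) (Icc z.1 w.1) :=
  hzw.eqOn_extremal (Classical.epsilon_spec ⟨_, hzw.isOptimalCurve_extremal⟩)

theorem prec_extremal {s : ℝ} (hs : s ∈ Ico z.1 w.1) : Prec (s, extremal z w s) w := by
  have hp := hzw.extPhi_pos_of_mem (Ico_subset_Icc_self hs)
  have hT := hzw.extPhi_pos_of_mem (right_mem_Icc.2 hzw.2.2.1.le)
  refine ⟨inv_pos.2 (pow_pos hp 2), hzw.2.1, hs.2, ?_⟩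
  have h := hzw.extremal_snd_sub hT.ne' hp.ne'
  have h2 : 0 < sinE (energy z w) (w.1 - s) :=
    sinE_pos (sub_pos.2 hs.2) (hzw.energy_gt (sub_pos.2 hs.2).le (by linarith [hs.1]))
  have h3 := div_pos h2 (mul_pos hp hT)
  rw [hzw.extremal_terminal] at h
  simp only
  linarith

/-- The increment formula for γ₂ gives h(s, γ(s)) = 1/g(E(T-s)²): the remaining arc has the same
energy E. -/
theorem rho_extremal {s : ℝ} (hs : s ∈ Ico z.1 w.1) :
    rho (s, extremal z w s) w = energy z w * (w.1 - s) ^ 2 := by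
  have hp := hzw.extPhi_pos_of_mem (Ico_subset_Icc_self hs)
  have hT := hzw.extPhi_pos_of_mem (right_mem_Icc.2 hzw.2.2.1.le)
  have hE := hzw.energy_gt (sub_pos.2 hs.2).le (by linarith [hs.1])
  rw [rho, ← gInv_gFun hE]
  congr 1
  have h := hzw.extremal_snd_sub hT.ne' hp.ne'
  rw [hzw.extremal_terminal] at h
  have h3 : √w.2.1 = (extPhi z w (w.1 - z.1))⁻¹ := by
    rw [hzw.extPhi_tau, inv_inv]
  have hg := (gFun_pos hE).ne'
  have hs0 := (sub_pos.2 hs.2).ne'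
  rw [hFun]
  simp only
  rw [h, sinE, Real.sqrt_mul (by simp only [extremal]; positivity), h3]
  simp only [extremal]
  rw [Real.sqrt_inv, Real.sqrt_sq hp.le]
  field_simp

/-! ### The value function -/

theorem psi_eq_cost : Psi z w = cost z w (extControl z w) := by
  refine IsLeast.csInf_eq ⟨⟨_, _, hzw.isAdmissible_extremal, rfl⟩, ?_⟩
  rintro _ ⟨c, γ, h, rfl⟩
  exact hzw.isOptimal_extremal.2 c γ h

theorem psi_eq : Psi z w = 4 / tau z w * (rho z w - 2 * (coshSqrt (rho z w) / gFun (rho z w))) +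
    4 * (z.2.1 + w.2.1) / (w.2.2 - z.2.2) := by
  have hle := hzw.2.2.1.le
  have hu := uIcc_of_le hle
  -- From φ'' = Eφ, (φ'/φ)' = E - (φ'/φ)², and ω² = 4(φ'/φ)².
  have hd : ∀ s ∈ uIcc z.1 w.1, HasDerivAt (fun s => 4 * energy z w * s -
      4 * (extPhi' z w (s - z.1) / extPhi z w (s - z.1))) (|extControl z w s| ^ 2) s := by
    intro s hs
    rw [hu] at hs
    have hp := (hzw.extPhi_pos_of_mem hs).ne'
    have h1 := ((hasDerivAt_phiE' (energy z w) (√z.2.1)⁻¹ (slope₀ z w) (s - z.1)).comp_sub_const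
      s z.1).div ((hasDerivAt_phiE (energy z w) (√z.2.1)⁻¹ (slope₀ z w) (s - z.1)).comp_sub_const
      s z.1) hp
    have h := ((hasDerivAt_id s).const_mul (4 * energy z w)).sub (h1.const_mul 4)
    convert! h using 1
    rw [← extPhi, ← extPhi', sq_abs, extControl]
    field_simp
    ring
  have hi : IntervalIntegrable (fun s => |extControl z w s| ^ 2) volume z.1 w.1 := by
    refine ContinuousOn.intervalIntegrable ?_
    rw [hu]
    exact hzw.continuousOn_extControl.abs.pow 2
  rw [hzw.psi_eq_cost, cost, intervalIntegral.integral_eq_sub_of_hasDerivAt hd hi]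
  have h1 := Real.sqrt_pos.2 hzw.1
  have h2 := Real.sqrt_pos.2 hzw.2.1
  have hT := hzw.extPhi_tau
  have hS := hzw.sinE_tau
  have hSp := hzw.sinE_tau_pos
  have h3 : extPhi z w (z.1 - z.1) = (√z.2.1)⁻¹ := by simp [extPhi]
  have h4 : extPhi' z w (z.1 - z.1) = slope₀ z w := by simp [extPhi']
  -- Running the solution backwards from T to t determines φ'(τ) from the two boundary values.
  have h5 := phiE_add (energy z w) (√z.2.1)⁻¹ (slope₀ z w) (tau z w) (-tau z w)
  rw [← extPhi, ← extPhi', cosE_neg, sinE_neg, hT, add_neg_cancel, extPhi, phiE_zero] at h5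
  have h6 : extPhi' z w (tau z w) = ((√w.2.1)⁻¹ * cosE (energy z w) (tau z w) - (√z.2.1)⁻¹) /
      sinE (energy z w) (tau z w) := by
    field_simp at h5 ⊢
    linear_combination h5
  have h7 : gFun (rho z w) = sinE (energy z w) (tau z w) / tau z w := by
    rw [sinE, hzw.energy_mul_sq, mul_div_cancel_left₀ _ hzw.tau_pos.ne']
  have h8 : coshSqrt (rho z w) = cosE (energy z w) (tau z w) := by
    rw [cosE, hzw.energy_mul_sq]
  have hA := sub_pos.2 hzw.2.2.2
  have e1 := Real.sq_sqrt hzw.1.le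
  have e2 := Real.sq_sqrt hzw.2.1.le
  have hτ := hzw.tau_pos
  rw [h3, h4, h6, hT, h7, h8, ← hzw.energy_mul_sq, slope₀, hS]
  generalize cosE (energy z w) (tau z w) = C
  generalize energy z w = E
  rw [← e1, ← e2]
  simp only [Real.sqrt_sq h1.le, Real.sqrt_sq h2.le]
  simp only [tau] at *
  field_simp
  ring

end Prec

/-! ### The profile of `u` -/

/-- `u` as a function of the reduced energy. -/
noncomputable def uProfile (r : ℝ) : ℝ := (√(6 * (gFun r * gDer r)))⁻¹

theorem gFun_mul_gDer_pos {r : ℝ} (hr : -π ^ 2 < r) : 0 < gFun r * gDer r :=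
  mul_pos (gFun_pos hr) (gDer_pos hr.le)

theorem uProfile_pos {r : ℝ} (hr : -π ^ 2 < r) : 0 < uProfile r := by
  have := gFun_mul_gDer_pos hr
  rw [uProfile]
  positivity

theorem uProfile_eq_exp {r : ℝ} (hr : -π ^ 2 < r) :
    uProfile r = exp (1 / 2 * (log (1 / 6) - log (gFun r * gDer r))) := by
  have h := gFun_mul_gDer_pos hr
  rw [← Real.log_div (by norm_num) h.ne', mul_comm, Real.exp_mul, Real.exp_log (by positivity),
    ← Real.sqrt_eq_rpow, uProfile, ← Real.sqrt_inv]
  congr 1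
  field_simp

theorem hasDerivAt_log_gFun_mul_gDer {r : ℝ} (hr : -π ^ 2 < r) :
    HasDerivAt (fun r => log (gFun r * gDer r)) (gDer r / gFun r + gDer₂ r / gDer r) r := by
  have h := ((hasDerivAt_gFun r).mul (hasDerivAt_gDer r)).log (gFun_mul_gDer_pos hr).ne'
  convert! h using 1
  have := (gFun_pos hr).ne'
  have := (gDer_pos hr.le).ne'
  simp only [Pi.mul_apply]
  field_simp

theorem hasDerivAt_uProfile {r : ℝ} (hr : -π ^ 2 < r) :
    HasDerivAt uProfile (-(1 / 2) * (gDer r / gFun r + gDer₂ r / gDer r) * uProfile r) r := by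
  have h := (((hasDerivAt_log_gFun_mul_gDer hr).const_sub (log (1 / 6))).const_mul (1 / 2)).exp
  have h2 : uProfile =ᶠ[𝓝 r]
      fun r => exp (1 / 2 * (log (1 / 6) - log (gFun r * gDer r))) := by
    filter_upwards [lt_mem_nhds hr] with x hx using uProfile_eq_exp hx
  convert! h.congr_of_eventuallyEq h2 using 1
  rw [← uProfile_eq_exp hr]
  ring

theorem contDiffAt_uProfile {r : ℝ} (hr : -π ^ 2 < r) {n : ℕ∞} : ContDiffAt ℝ n uProfile r := by
  have h := gFun_mul_gDer_pos hr
  have h1 : ContDiffAt ℝ n (fun r => 6 * (gFun r * gDer r)) r :=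
    (contDiff_const.mul (contDiff_gFun.mul contDiff_gDer)).contDiffAt
  exact (h1.sqrt (by positivity)).inv (by positivity)

theorem vFun_four_mul {r : ℝ} (hr : -π ^ 2 < r) : vFun (4 * r) = uProfile r := by
  have hg := gFun_mul_gDer_pos hr
  have key : ∀ R D : ℝ, 0 < R → D = 4 * R ^ 2 * (6 * (gFun r * gDer r)) →
      4 * R / (2 * √D) = uProfile r := by
    rintro R D hR rfl
    have : √(4 * R ^ 2 * (6 * (gFun r * gDer r))) = 2 * R * √(6 * (gFun r * gDer r)) := by
      rw [Real.sqrt_mul (by positivity), show 4 * R ^ 2 = (2 * R) ^ 2 by ring,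
        Real.sqrt_sq (by positivity)]
    rw [this, uProfile]
    field_simp
    norm_num
  have h4 : √4 = 2 := by rw [show (4 : ℝ) = 2 ^ 2 by norm_num, Real.sqrt_sq (by norm_num)]
  rcases lt_trichotomy r 0 with h | rfl | h
  · have hs : 0 < √(-r) := Real.sqrt_pos.2 (by linarith)
    have hC := coshSqrt_of_neg h
    have hS := gFun_of_neg h
    have h1 : √(-(4 * r)) = 2 * √(-r) := by
      rw [show -(4 * r) = 4 * -r by ring, Real.sqrt_mul (by norm_num), h4]
    have hsq := Real.sq_sqrt (show 0 ≤ -r by linarith)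
    rw [vFun, if_neg (by linarith), if_neg (by linarith), abs_of_neg (by linarith), h1,
      sin_two_mul, cos_two_mul, show -(4 * r) = 4 * -r by ring]
    -- The double-angle formulas turn the radicand into 24 r² g g'.
    refine key (-r) _ (by linarith) ?_
    have h5 := sin_sq_add_cos_sq (√(-r))
    have h6 : sin √(-r) = √(-r) * gFun r := by rw [hS]; field_simp
    rw [coshSqrt] at hC
    rw [h6, ← hC] at h5 ⊢
    generalize √(-r) = x at *
    obtain rfl : r = -x ^ 2 := by linarith
    linear_combination -12 * h5
  · simp [vFun, uProfile, gFun_zero, gDer_zero]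
  · have hs : 0 < √r := Real.sqrt_pos.2 h
    have hC := coshSqrt_of_pos h
    have hS := gFun_of_pos h
    have h1 : √(4 * r) = 2 * √r := by
      rw [Real.sqrt_mul (by norm_num), h4]
    have hsq := Real.sq_sqrt h.le
    rw [vFun, if_pos (by linarith), abs_of_pos (by linarith), h1, sinh_two_mul, cosh_two_mul]
    refine key r _ h ?_
    have h5 := cosh_sq (√r)
    have h6 : sinh √r = √r * gFun r := by rw [hS]; field_simp
    rw [coshSqrt] at hC
    rw [h6, ← hC] at h5 ⊢
    generalize √r = x at *
    subst hsq
    linear_combination -6 * h5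

/-! ### Derivatives of functions of the reduced energy -/

theorem contDiffAt_rho {z w : Pt} (hzw : Prec z w) {n : ℕ∞} :
    ContDiffAt ℝ n (fun ζ => rho ζ w) z := by
  have hh : ContDiffAt ℝ n (fun ζ : Pt => hFun ζ w) z := by
    have h1 : ContDiffAt ℝ n (fun ζ : Pt => √(ζ.2.1 * w.2.1)) z :=
      ContDiffAt.sqrt (by fun_prop) (mul_pos hzw.1 hzw.2.1).ne'
    have h2 : ContDiffAt ℝ n (fun ζ : Pt => w.1 - ζ.1) z := by fun_prop
    have h3 : ContDiffAt ℝ n (fun ζ : Pt => w.2.2 - ζ.2.2) z := by fun_prop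
    exact (h2.mul h1).div h3 (sub_pos.2 hzw.2.2.2).ne'
  exact ContDiffAt.comp z (contDiffAt_gInv (one_div_pos.2 hzw.hFun_pos))
    (contDiffAt_const.div hh hzw.hFun_pos.ne')

namespace Prec

variable {z w : Pt} (hzw : Prec z w)

include hzw

/-- Logarithmic differentiation of g(ρ) = (y₂-x₂)/(τ√(x₁y₁)); likewise for the two space
derivatives. -/
theorem hasDerivAt_rho_t : HasDerivAt (fun r => rho (r, z.2.1, z.2.2) w)
    (gFun (rho z w) / (tau z w * gDer (rho z w))) z.1 := by
  have h0 := hzw.hFun_pos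
  have hN := (gDer_pos hzw.rho_gt.le).ne'
  have hτ := hzw.tau_pos.ne'
  have hA := (sub_pos.2 hzw.2.2.2).ne'
  have hx := (Real.sqrt_pos.2 (mul_pos hzw.1 hzw.2.1)).ne'
  have h1 : HasDerivAt (fun r => hFun (r, z.2.1, z.2.2) w) _ z.1 :=
    (((hasDerivAt_id z.1).const_sub w.1).mul_const (√(z.2.1 * w.2.1))).div_const (w.2.2 - z.2.2)
  have h2 := (hasDerivAt_gInv (one_div_pos.2 h0)).comp z.1
    ((hasDerivAt_const z.1 (1 : ℝ)).div h1 h0.ne')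
  convert! h2 using 1
  rw [← rho, hzw.gFun_rho, hFun]
  field_simp
  simp

theorem hasDerivAt_rho_x₁ : HasDerivAt (fun r => rho (z.1, r, z.2.2) w)
    (-(gFun (rho z w) / (2 * z.2.1 * gDer (rho z w)))) z.2.1 := by
  have h0 := hzw.hFun_pos
  have hN := (gDer_pos hzw.rho_gt.le).ne'
  have hτ := hzw.tau_pos.ne'
  have hA := (sub_pos.2 hzw.2.2.2).ne'
  have hx := Real.sqrt_pos.2 (mul_pos hzw.1 hzw.2.1)
  have hx0 := hzw.1.ne'
  have h1 : HasDerivAt (fun r => hFun (z.1, r, z.2.2) w) _ z.2.1 :=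
    ((((hasDerivAt_id z.2.1).mul_const w.2.1).sqrt (mul_pos hzw.1 hzw.2.1).ne').const_mul
      (w.1 - z.1)).div_const (w.2.2 - z.2.2)
  have h2 := (hasDerivAt_gInv (one_div_pos.2 h0)).comp z.2.1
    ((hasDerivAt_const z.2.1 (1 : ℝ)).div h1 h0.ne')
  convert! h2 using 1
  have hs := Real.sq_sqrt (mul_pos hzw.1 hzw.2.1).le
  rw [← rho, hzw.gFun_rho, hFun]
  simp only [id, one_mul]
  generalize √(z.2.1 * w.2.1) = q at *
  field_simp
  rw [hs]
  ring

theorem hasDerivAt_rho_x₂ : HasDerivAt (fun r => rho (z.1, z.2.1, r) w)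
    (-(gFun (rho z w) / ((w.2.2 - z.2.2) * gDer (rho z w)))) z.2.2 := by
  have h0 := hzw.hFun_pos
  have hN := (gDer_pos hzw.rho_gt.le).ne'
  have hτ := hzw.tau_pos.ne'
  have hA := (sub_pos.2 hzw.2.2.2).ne'
  have hx := (Real.sqrt_pos.2 (mul_pos hzw.1 hzw.2.1)).ne'
  have h1 : HasDerivAt (fun r => hFun (z.1, z.2.1, r) w) _ z.2.2 :=
    (hasDerivAt_const z.2.2 ((w.1 - z.1) * √(z.2.1 * w.2.1))).div
      ((hasDerivAt_id z.2.2).const_sub w.2.2) hA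
  have h2 := (hasDerivAt_gInv (one_div_pos.2 h0)).comp z.2.2
    ((hasDerivAt_const z.2.2 (1 : ℝ)).div h1 h0.ne')
  convert! h2 using 1
  rw [← rho, hzw.gFun_rho, hFun]
  simp only
  field_simp
  simp

omit hzw in
theorem of_x₁ {r : ℝ} (hr : 0 < r) (hzw : Prec z w) : Prec (z.1, r, z.2.2) w :=
  ⟨hr, hzw.2⟩

theorem eventually_x₁ : ∀ᶠ r in 𝓝 z.2.1, Prec (z.1, r, z.2.2) w := by
  filter_upwards [lt_mem_nhds hzw.1] with r hr using of_x₁ hr hzw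

theorem eventually_x₂ : ∀ᶠ r in 𝓝 z.2.2, Prec (z.1, z.2.1, r) w := by
  filter_upwards [gt_mem_nhds hzw.2.2.2] with r hr using ⟨hzw.1, hzw.2.1, hzw.2.2.1, hr⟩

theorem eventually_t : ∀ᶠ r in 𝓝 z.1, Prec (r, z.2.1, z.2.2) w := by
  filter_upwards [gt_mem_nhds hzw.2.2.1] with r hr using ⟨hzw.1, hzw.2.1, hr, hzw.2.2.2⟩

theorem contDiffOn_psi : ContDiffOn ℝ 2 (fun r => Psi (z.1, r, z.2.2) w) (Ioi 0) := by
  have h : ContDiffOn ℝ 2 (fun r => 4 / tau z w * (rho (z.1, r, z.2.2) w -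
      2 * (coshSqrt (rho (z.1, r, z.2.2) w) / gFun (rho (z.1, r, z.2.2) w))) +
      4 * (r + w.2.1) / (w.2.2 - z.2.2)) (Ioi 0) := by
    intro r hr
    have hr' := of_x₁ hr hzw
    have h1 : ContDiffAt ℝ 2 (fun r => rho (z.1, r, z.2.2) w) r :=
      ContDiffAt.comp r (contDiffAt_rho (n := 2) hr') (f := fun r : ℝ => (z.1, r, z.2.2))
        (by fun_prop)
    have h2 : ContDiffAt ℝ 2 (fun r => coshSqrt (rho (z.1, r, z.2.2) w)) r :=
      (contDiff_coshSqrt (n := 2)).contDiffAt.comp r h1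
    have h3 : ContDiffAt ℝ 2 (fun r => gFun (rho (z.1, r, z.2.2) w)) r :=
      contDiff_gFun.contDiffAt.comp r h1
    have h4 : ContDiffAt ℝ 2 (fun r => 4 * (r + w.2.1) / (w.2.2 - z.2.2)) r := by fun_prop
    exact ((contDiffAt_const.mul (h1.sub (contDiffAt_const.mul
      (h2.div h3 (gFun_pos hr'.rho_gt).ne')))).add h4).contDiffWithinAt
  exact h.congr fun r hr => (of_x₁ hr hzw).psi_eq

/-- Since (cosh √r)' = g/2, the r-derivative of r - 2 cosh √r / g is 2 g' cosh √r / g². Its factor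
g' cancels against ∂ρ/∂x₁. -/
theorem partialX₁_psi : partialX₁ (fun ζ => Psi ζ w) z =
    4 / (w.2.2 - z.2.2) - 4 / tau z w * (coshSqrt (rho z w) / gFun (rho z w)) / z.2.1 := by
  have hN := (gDer_pos hzw.rho_gt.le).ne'
  have hg := (gFun_pos hzw.rho_gt).ne'
  have hA := (sub_pos.2 hzw.2.2.2).ne'
  have hτ := hzw.tau_pos.ne'
  have hx := hzw.1.ne'
  have hρ := hzw.hasDerivAt_rho_x₁
  have h1 := (((hρ.sub ((((hasDerivAt_coshSqrt _).comp z.2.1 hρ).div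
    ((hasDerivAt_gFun _).comp z.2.1 hρ) hg).const_mul 2)).const_mul (4 / tau z w)).add
    ((((hasDerivAt_id z.2.1).add_const w.2.1).const_mul 4).div_const (w.2.2 - z.2.2)))
  have h2 : (fun r => Psi (z.1, r, z.2.2) w) =ᶠ[𝓝 z.2.1] _ :=
    hzw.eventually_x₁.mono fun r hr => hr.psi_eq
  rw [partialX₁, (h1.congr_of_eventuallyEq h2).deriv]
  simp only [Function.comp]
  field_simp
  ring

/-- The singular term 2/(T-t) is absorbed. Along the extremal ρ/τ = E(T-s), so f stays bounded up to
s = T. -/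
theorem fCoeff_eq : fCoeff z w = -(rho z w / tau z w *
    (gDer (rho z w) / gFun (rho z w) + gDer₂ (rho z w) / gDer (rho z w))) := by
  have hN := (gDer_pos hzw.rho_gt.le).ne'
  have hg := (gFun_pos hzw.rho_gt).ne'
  have hτ := hzw.tau_pos.ne'
  have hx := hzw.1.ne'
  have hρ := hzw.hasDerivAt_rho_x₁
  have h1 := ((((((hasDerivAt_coshSqrt _).comp z.2.1 hρ).div
    ((hasDerivAt_gFun _).comp z.2.1 hρ) hg).const_mul (4 / tau z w)).div
    (hasDerivAt_id z.2.1) hx).const_sub (4 / (w.2.2 - z.2.2)))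
  have h2 : (fun r => partialX₁ (fun ζ => Psi ζ w) (z.1, r, z.2.2)) =ᶠ[𝓝 z.2.1] _ :=
    hzw.eventually_x₁.mono fun r hr => hr.partialX₁_psi
  have h3 := two_mul_gDer₂ (rho z w)
  rw [fCoeff, partialX₁, (h1.congr_of_eventuallyEq h2).deriv]
  simp only [Function.comp, id, Pi.div_apply]
  rw [coshSqrt, ← tau]
  field_simp
  linear_combination (2 * gFun (rho z w)) * h3

theorem driftCoeff_eq : driftCoeff z w = 2 * z.2.1 ^ 2 / (w.2.2 - z.2.2) -
    2 * z.2.1 / tau z w * (coshSqrt (rho z w) / gFun (rho z w)) := by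
  have hx := hzw.1.ne'
  rw [driftCoeff, hzw.partialX₁_psi]
  field_simp
  norm_num

/-! ### The closed form of `u` -/

theorem hasDerivAt_log_profile {s : ℝ} (hs : s ∈ Icc z.1 w.1) :
    HasDerivAt (fun s => 1 / 2 * log (gFun (energy z w * (w.1 - s) ^ 2) *
        gDer (energy z w * (w.1 - s) ^ 2)))
      (-(energy z w * (w.1 - s) * (gDer (energy z w * (w.1 - s) ^ 2) /
        gFun (energy z w * (w.1 - s) ^ 2) + gDer₂ (energy z w * (w.1 - s) ^ 2) /
        gDer (energy z w * (w.1 - s) ^ 2)))) s := by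
  have hE := hzw.energy_gt (sub_nonneg.2 hs.2) (by linarith [hs.1])
  have h0 : HasDerivAt (fun s => energy z w * (w.1 - s) ^ 2) (-2 * (energy z w * (w.1 - s))) s := by
    have h := (((hasDerivAt_id s).const_sub w.1).pow 2).const_mul (energy z w)
    convert! h using 1
    simp
    ring
  convert! ((hasDerivAt_log_gFun_mul_gDer hE).comp s h0).const_mul (1 / 2) using 1
  ring

theorem fCoeff_extremal {s : ℝ} (hs : s ∈ Ico z.1 w.1) :
    fCoeff (s, extremal z w s) w = -(energy z w * (w.1 - s) *
      (gDer (energy z w * (w.1 - s) ^ 2) / gFun (energy z w * (w.1 - s) ^ 2) +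
        gDer₂ (energy z w * (w.1 - s) ^ 2) / gDer (energy z w * (w.1 - s) ^ 2))) := by
  have := (sub_pos.2 hs.2).ne'
  rw [(hzw.prec_extremal hs).fCoeff_eq, hzw.rho_extremal hs, tau]
  field_simp

theorem intervalIntegrable_profile : IntervalIntegrable (fun s => -(energy z w * (w.1 - s) *
      (gDer (energy z w * (w.1 - s) ^ 2) / gFun (energy z w * (w.1 - s) ^ 2) +
        gDer₂ (energy z w * (w.1 - s) ^ 2) / gDer (energy z w * (w.1 - s) ^ 2))))
    volume z.1 w.1 := by
  refine ContinuousOn.intervalIntegrable ?_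
  rw [uIcc_of_le hzw.2.2.1.le]
  have hE : ∀ s ∈ Icc z.1 w.1, -π ^ 2 < energy z w * (w.1 - s) ^ 2 := fun s hs =>
    hzw.energy_gt (sub_nonneg.2 hs.2) (by linarith [hs.1])
  have h0 : Continuous fun s => energy z w * (w.1 - s) ^ 2 := by fun_prop
  have h1 := ((contDiff_gFun (n := 0)).continuous.comp h0).continuousOn (s := Icc z.1 w.1)
  have h2 := ((contDiff_gDer (n := 0)).continuous.comp h0).continuousOn (s := Icc z.1 w.1)
  have h3 := ((contDiff_gDer₂ (n := 0)).continuous.comp h0).continuousOn (s := Icc z.1 w.1)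
  refine (ContinuousOn.mul (by fun_prop) ((h2.div h1 fun s hs => ?_).add
    (h3.div h2 fun s hs => ?_))).neg
  · exact (gFun_pos (hE s hs)).ne'
  · exact (gDer_pos (hE s hs).le).ne'

theorem fCoeff_ae_eq {γ : ℝ → ℝ × ℝ} (hγ : EqOn γ (extremal z w) (Icc z.1 w.1)) :
    ∀ᵐ s, s ∈ uIoc z.1 w.1 → -(energy z w * (w.1 - s) *
      (gDer (energy z w * (w.1 - s) ^ 2) / gFun (energy z w * (w.1 - s) ^ 2) +
        gDer₂ (energy z w * (w.1 - s) ^ 2) / gDer (energy z w * (w.1 - s) ^ 2))) =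
      fCoeff (s, γ s) w := by
  -- The terminal time is excluded, as (T, γ(T)) does not precede w.
  filter_upwards [measure_eq_zero_iff_ae_notMem.1 (measure_singleton (μ := volume) w.1)]
    with s hs hs'
  rw [uIoc_of_le hzw.2.2.1.le] at hs'
  rw [hγ (Ioc_subset_Icc_self hs')]
  exact (hzw.fCoeff_extremal ⟨hs'.1.le, lt_of_le_of_ne hs'.2 hs⟩).symm

theorem intervalIntegrable_fCoeff {γ : ℝ → ℝ × ℝ} (hγ : EqOn γ (extremal z w) (Icc z.1 w.1)) :
    IntervalIntegrable (fun s => fCoeff (s, γ s) w) volume z.1 w.1 :=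
  hzw.intervalIntegrable_profile.congr_ae
    ((ae_restrict_iff' measurableSet_uIoc).2 (hzw.fCoeff_ae_eq hγ))

theorem exp_integral_fCoeff {γ : ℝ → ℝ × ℝ} (hγ : EqOn γ (extremal z w) (Icc z.1 w.1)) :
    exp (∫ s in z.1..w.1, fCoeff (s, γ s) w) = uProfile (rho z w) := by
  rw [← intervalIntegral.integral_congr_ae (hzw.fCoeff_ae_eq hγ),
    intervalIntegral.integral_eq_sub_of_hasDerivAt
      (fun s hs => hzw.hasDerivAt_log_profile (by rwa [uIcc_of_le hzw.2.2.1.le] at hs))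
      hzw.intervalIntegrable_profile, uProfile_eq_exp hzw.rho_gt, hzw.energy_mul_sq]
  simp only [sub_self, ne_eq, OfNat.ofNat_ne_zero, not_false_eq_true, zero_pow, mul_zero,
    gFun_zero, gDer_zero, one_mul]
  ring_nf

theorem uCorr_eq : uCorr z w = uProfile (rho z w) :=
  hzw.exp_integral_fCoeff hzw.eqOn_optimalCurve

/-! ### The transport equation -/

theorem partialX₁_uCorr : partialX₁ (fun ζ => uCorr ζ w) z =
    1 / 4 * ((1 + gFun (rho z w) * gDer₂ (rho z w) / gDer (rho z w) ^ 2) *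
      uProfile (rho z w)) / z.2.1 := by
  have hN := (gDer_pos hzw.rho_gt.le).ne'
  have hg := (gFun_pos hzw.rho_gt).ne'
  have hx := hzw.1.ne'
  have h1 := (hasDerivAt_uProfile hzw.rho_gt).comp z.2.1 hzw.hasDerivAt_rho_x₁
  have h2 : (fun r => uCorr (z.1, r, z.2.2) w) =ᶠ[𝓝 z.2.1] _ :=
    hzw.eventually_x₁.mono fun r hr => hr.uCorr_eq
  rw [partialX₁, (h1.congr_of_eventuallyEq h2).deriv]
  field_simp
  ring

theorem partialX₂_uCorr : partialX₂ (fun ζ => uCorr ζ w) z =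
    1 / 2 * ((1 + gFun (rho z w) * gDer₂ (rho z w) / gDer (rho z w) ^ 2) *
      uProfile (rho z w)) / (w.2.2 - z.2.2) := by
  have hN := (gDer_pos hzw.rho_gt.le).ne'
  have hg := (gFun_pos hzw.rho_gt).ne'
  have hA := (sub_pos.2 hzw.2.2.2).ne'
  have h1 := (hasDerivAt_uProfile hzw.rho_gt).comp z.2.2 hzw.hasDerivAt_rho_x₂
  have h2 : (fun r => uCorr (z.1, z.2.1, r) w) =ᶠ[𝓝 z.2.2] _ :=
    hzw.eventually_x₂.mono fun r hr => hr.uCorr_eq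
  rw [partialX₂, (h1.congr_of_eventuallyEq h2).deriv]
  field_simp

theorem partialT_uCorr : partialT (fun ζ => uCorr ζ w) z =
    -(1 / 2 * ((1 + gFun (rho z w) * gDer₂ (rho z w) / gDer (rho z w) ^ 2) *
      uProfile (rho z w)) / tau z w) := by
  have hN := (gDer_pos hzw.rho_gt.le).ne'
  have hg := (gFun_pos hzw.rho_gt).ne'
  have hτ := hzw.tau_pos.ne'
  have h1 := (hasDerivAt_uProfile hzw.rho_gt).comp z.1 hzw.hasDerivAt_rho_t
  have h2 : (fun r => uCorr (r, z.2.1, z.2.2) w) =ᶠ[𝓝 z.1] _ :=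
    hzw.eventually_t.mono fun r hr => hr.uCorr_eq
  rw [partialT, (h1.congr_of_eventuallyEq h2).deriv]
  field_simp

/-- As u depends on z through ρ only, the operator acts as -2(ρ/τ) d/dρ, and the equation reduces to
the logarithmic derivative of (g g')^(-1/2). -/
theorem transport : fieldY (fun ζ => uCorr ζ w) z -
    driftCoeff z w * partialX₁ (fun ζ => uCorr ζ w) z + fCoeff z w * uCorr z w = 0 := by
  have hN := (gDer_pos hzw.rho_gt.le).ne'
  have hg := (gFun_pos hzw.rho_gt).ne'
  have hτ := hzw.tau_pos.ne'
  have hA := (sub_pos.2 hzw.2.2.2).ne'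
  have hx := hzw.1.ne'
  rw [fieldY, hzw.partialT_uCorr, hzw.partialX₂_uCorr, hzw.partialX₁_uCorr, hzw.driftCoeff_eq,
    hzw.fCoeff_eq, hzw.uCorr_eq, coshSqrt]
  field_simp
  ring

end Prec

theorem contDiffOn_uCorr (w : Pt) : ContDiffOn ℝ ∞ (fun z => uCorr z w) {z | Prec z w} := by
  have h : ContDiffOn ℝ ∞ (fun z => uProfile (rho z w)) {z | Prec z w} := fun z hz =>
    (ContDiffAt.comp z (contDiffAt_uProfile hz.rho_gt) (contDiffAt_rho hz)).contDiffWithinAt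
  exact h.congr fun z hz => hz.uCorr_eq

/-! ### Bounds -/

theorem three_mul_cosh_le {x : ℝ} (hx : 0 ≤ x) : 3 * (x * cosh x) ≤ (x ^ 2 + 3) * sinh x := by
  have hd : ∀ y, HasDerivAt (fun y => (y ^ 2 + 3) * sinh y - 3 * (y * cosh y))
      (y * (y * cosh y - sinh y)) y := fun y => by
    have := ((((hasDerivAt_id y).pow 2).add_const 3).mul (hasDerivAt_sinh y)).sub
      (((hasDerivAt_id y).mul (hasDerivAt_cosh y)).const_mul 3)
    convert! this using 1
    simp
    ring
  have := monotoneOn_of_deriv_nonneg (convex_Ici (0 : ℝ))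
    (f := fun y => (y ^ 2 + 3) * sinh y - 3 * (y * cosh y))
    (fun y _ => (hd y).continuousAt.continuousWithinAt)
    (fun y _ => (hd y).differentiableAt.differentiableWithinAt) (fun y hy => by
      rw [interior_Ici, mem_Ioi] at hy
      rw [(hd y).deriv]
      exact mul_nonneg hy.le (sub_nonneg.2 (sinh_lt_mul_cosh hy).le)) self_mem_Ici hx hx
  simp at this
  linarith

theorem six_mul_gDer_le {r : ℝ} (hr : 0 ≤ r) : 6 * gDer r ≤ gFun r := by
  rcases hr.eq_or_lt with rfl | hr
  · simp [gDer_zero, gFun_zero]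
  have hs : 0 < √r := Real.sqrt_pos.2 hr
  have h := three_mul_cosh_le hs.le
  have hC := coshSqrt_of_pos hr
  have h6 : sinh √r = √r * gFun r := by rw [gFun_of_pos hr]; field_simp
  rw [coshSqrt] at hC
  rw [h6, ← hC, Real.sq_sqrt hr.le] at h
  have : 3 * (gFun r + 2 * r * gDer r) ≤ (r + 3) * gFun r := by
    refine le_of_mul_le_mul_left ?_ hs
    linarith
  nlinarith

/-- With x = √r ≥ 2, sinh x < cosh x reads x g < g + 2x² g', and x - 1 ≥ x/2. -/
theorem gFun_le_mul_gDer {r : ℝ} (hr : 4 ≤ r) : gFun r ≤ 4 * √r * gDer r := by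
  have hr0 : 0 < r := by linarith
  have hs : 2 ≤ √r := Real.le_sqrt_of_sq_le (by linarith)
  have hC := coshSqrt_of_pos hr0
  have h6 : sinh √r = √r * gFun r := by rw [gFun_of_pos hr0]; field_simp
  have h7 := (sinh_lt_cosh √r).le
  have hg := gFun_pos (r := r) (by nlinarith [pi_pos])
  rw [coshSqrt] at hC
  rw [h6, ← hC] at h7
  have hsq := Real.sq_sqrt hr0.le
  generalize √r = x at *
  subst hsq
  have h8 : x * gFun (x ^ 2) ≤ x * (4 * x * gDer (x ^ 2)) := by nlinarith
  exact le_of_mul_le_mul_left h8 (by linarith)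

theorem exists_gDer_ge : ∃ c > 0, ∀ r, -π ^ 2 < r → c ≤ gDer r := by
  obtain ⟨r₀, hr₀, hmin⟩ := isCompact_Icc.exists_isMinOn (s := Icc (-π ^ 2) 4)
    ⟨4, by nlinarith [pi_pos], le_rfl⟩ (contDiff_gDer (n := 0)).continuous.continuousOn
  refine ⟨min (gDer r₀) (1 / 10), lt_min (gDer_pos hr₀.1) (by norm_num), fun r hr => ?_⟩
  rcases le_total r 4 with h | h
  · exact (min_le_left _ _).trans (hmin ⟨hr.le, h⟩)
  · refine (min_le_right _ _).trans ?_
    have h1 := gFun_le_mul_gDer h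
    have h2 := one_add_div_six_le_gFun (r := r) (by linarith)
    have hs : 0 < √r := Real.sqrt_pos.2 (by linarith)
    have hsq := Real.sq_sqrt (show 0 ≤ r by linarith)
    -- The constant 1/10 works because 1 + x²/6 ≥ 2x/5 for every x; the square completes this
    -- quadratic.
    have h3 : 4 * √r * (1 / 10) ≤ 4 * √r * gDer r := by nlinarith [sq_nonneg (√r - 6 / 5)]
    exact le_of_mul_le_mul_left h3 (by linarith)

theorem exists_uProfile_le : ∃ K > 0, ∀ r, -π ^ 2 < r → uProfile r ≤ K * (√(gFun r))⁻¹ := by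
  obtain ⟨c, hc, h⟩ := exists_gDer_ge
  refine ⟨(√(6 * c))⁻¹, by positivity, fun r hr => ?_⟩
  have hg := gFun_pos hr
  rw [uProfile, ← mul_inv, ← Real.sqrt_mul (by positivity)]
  have := mul_le_mul_of_nonneg_left (h r hr) hg.le
  gcongr ?_⁻¹
  exact Real.sqrt_le_sqrt (by linarith)

theorem inv_gFun_le_uProfile {r : ℝ} (hr : 0 ≤ r) : (gFun r)⁻¹ ≤ uProfile r := by
  have hr' : -π ^ 2 < r := by nlinarith [pi_pos, pow_pos pi_pos 2]
  have hg := gFun_pos hr'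
  have hN := gDer_pos hr'.le
  rw [uProfile]
  gcongr
  rw [Real.sqrt_le_left hg.le]
  nlinarith [six_mul_gDer_le hr]

/-- The ratio `g g'' / g' ^ 2`. -/
noncomputable def gRatio (r : ℝ) : ℝ := gFun r * gDer₂ r / gDer r ^ 2

/-- The derivative of `gRatio`. -/
noncomputable def gRatio' (r : ℝ) : ℝ :=
  ((gDer r * gDer₂ r + gFun r * deriv gDer₂ r) * gDer r - 2 * gFun r * gDer₂ r ^ 2) / gDer r ^ 3

theorem hasDerivAt_gDer₂ (r : ℝ) : HasDerivAt gDer₂ (deriv gDer₂ r) r :=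
  ((contDiff_gDer₂ (n := 1)).differentiable (by simp) r).hasDerivAt

theorem hasDerivAt_gRatio {r : ℝ} (hr : -π ^ 2 < r) : HasDerivAt gRatio (gRatio' r) r := by
  have hN := (gDer_pos hr.le).ne'
  have h := ((hasDerivAt_gFun r).mul (hasDerivAt_gDer₂ r)).div ((hasDerivAt_gDer r).pow 2)
    (pow_ne_zero 2 hN)
  convert! h using 1
  simp only [gRatio', Pi.mul_apply, Pi.pow_apply]
  field_simp
  norm_num
  ring

theorem two_mul_deriv_gDer₂ (r : ℝ) : 2 * r * deriv gDer₂ r = gDer r / 2 - 5 * gDer₂ r := by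
  have h1 := ((hasDerivAt_id r).const_mul 2).mul (hasDerivAt_gDer₂ r)
  have h2 := ((hasDerivAt_gFun r).div_const 2).sub ((hasDerivAt_gDer r).const_mul 3)
  have h3 : ((fun y : ℝ => 2 * id y) * gDer₂) = (fun x => gFun x / 2) - fun y => 3 * gDer y := by
    funext x
    simpa using two_mul_gDer₂ x
  rw [h3] at h1
  have := h1.unique h2
  simp only [id, mul_one] at this
  linarith

/-- The differential equation for g expresses both quantities through y = g/g' and r, for instance g
g''/g'² = y(y-6)/(4r). The bounds 6 ≤ y ≤ 4√r then suffice. -/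
theorem bound_of_four_le {r : ℝ} (hr : 4 ≤ r) :
    |gRatio r| ≤ 4 ∧ |gFun r / gDer r * gRatio' r| ≤ 32 := by
  have hr' : -π ^ 2 < r := by nlinarith [pi_pos]
  have hN := gDer_pos hr'.le
  have hr0 : 0 < r := by linarith
  have h1 := six_mul_gDer_le hr0.le
  have h2 := gFun_le_mul_gDer hr
  have e2 := two_mul_gDer₂ r
  have e3 := two_mul_deriv_gDer₂ r
  have hs : 2 ≤ √r := Real.le_sqrt_of_sq_le (by linarith)
  have hsq := Real.sq_sqrt hr0.le
  have eN₂ : gDer₂ r = (gFun r / 2 - 3 * gDer r) / (2 * r) := by field_simp; linarith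
  have eN₃ : deriv gDer₂ r = (gDer r / 2 - 5 * gDer₂ r) / (2 * r) := by field_simp; linarith
  obtain ⟨y, hy⟩ : ∃ y, y = gFun r / gDer r := ⟨_, rfl⟩
  have hy6 : 6 ≤ y := by rw [hy, le_div_iff₀ hN]; linarith
  have hyx : y ≤ 4 * √r := by rw [hy, div_le_iff₀ hN]; linarith
  have hgy : gFun r = y * gDer r := by rw [hy]; field_simp
  have hM : gRatio r = y * (y - 6) / (4 * r) := by
    rw [gRatio, eN₂, hgy]
    field_simp
    ring
  have hD : gFun r / gDer r * gRatio' r =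
      y * ((2 * y - 6) * (1 - gRatio r) / 4 - gRatio r) / r := by
    rw [hM, gRatio', eN₃, eN₂, hgy]
    field_simp
    ring
  have hy2 : y ^ 2 ≤ 16 * r := by nlinarith
  have hM0 : 0 ≤ gRatio r := by
    rw [hM]
    exact div_nonneg (mul_nonneg (by linarith) (by linarith)) (by linarith)
  have hM4 : gRatio r ≤ 4 := by
    rw [hM, div_le_iff₀ (by linarith)]
    nlinarith
  refine ⟨abs_le.2 ⟨by linarith, hM4⟩, ?_⟩
  have hyr : y ≤ 2 * r := by nlinarith
  rw [hD, abs_div, abs_of_pos hr0, div_le_iff₀ hr0, abs_mul, abs_of_nonneg (by linarith : 0 ≤ y)]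
  have h3 : |(2 * y - 6) * (1 - gRatio r) / 4 - gRatio r| ≤ 3 / 2 * y + 4 := by
    generalize gRatio r = m at *
    rw [abs_le]
    constructor <;> nlinarith
  calc y * _ ≤ y * (3 / 2 * y + 4) := by gcongr
    _ ≤ 32 * r := by nlinarith

theorem exists_gRatio_bound : ∃ K > 0, ∀ r, -π ^ 2 < r →
    |gRatio r| ≤ K ∧ |gFun r / gDer r * gRatio' r| ≤ K := by
  have hg := (contDiff_gFun (n := 0)).continuous.continuousOn (s := Icc (-π ^ 2) 4)
  have hN := (contDiff_gDer (n := 0)).continuous.continuousOn (s := Icc (-π ^ 2) 4)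
  have hN₂ := (contDiff_gDer₂ (n := 0)).continuous.continuousOn (s := Icc (-π ^ 2) 4)
  have hN₃ := ((contDiff_gDer₂ (n := 1)).continuous_deriv (by simp)).continuousOn
    (s := Icc (-π ^ 2) 4)
  have hN0 : ∀ r ∈ Icc (-π ^ 2) 4, gDer r ≠ 0 := fun r hr => (gDer_pos hr.1).ne'
  obtain ⟨C₁, hC₁⟩ := isCompact_Icc.exists_bound_of_continuousOn (f := gRatio)
    ((hg.mul hN₂).div (hN.pow 2) fun r hr => pow_ne_zero 2 (hN0 r hr))
  obtain ⟨C₂, hC₂⟩ := isCompact_Icc.exists_bound_of_continuousOn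
    (f := fun r => gFun r / gDer r * gRatio' r)
    ((hg.div hN hN0).mul (((((hN.mul hN₂).add (hg.mul hN₃)).mul hN).sub
      ((continuousOn_const.mul hg).mul (hN₂.pow 2))).div (hN.pow 3)
        fun r hr => pow_ne_zero 3 (hN0 r hr)))
  refine ⟨max 32 (max C₁ C₂), by positivity, fun r hr => ?_⟩
  rcases le_total r 4 with h | h
  · exact ⟨(hC₁ r ⟨hr.le, h⟩).trans ((le_max_left _ _).trans (le_max_right _ _)),
      (hC₂ r ⟨hr.le, h⟩).trans ((le_max_right _ _).trans (le_max_right _ _))⟩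
  · have := bound_of_four_le h
    exact ⟨(this.1.trans (by norm_num)).trans (le_max_left _ _), this.2.trans (le_max_left _ _)⟩

/-! ### The second x₁-derivative of u and the final estimates -/

namespace Prec

variable {z w : Pt} (hzw : Prec z w)

include hzw

/-- On functions of ρ, D = x₁∂₁ acts as -(g/(2g')) d/dρ, and x₁²∂₁² = D² - D. With M = g g''/g'² one
has Du = (1+M)u/4, and D is applied once more. -/
theorem sq_mul_partialX₁_partialX₁_uCorr :
    z.2.1 ^ 2 * partialX₁ (partialX₁ fun ζ => uCorr ζ w) z =
      uProfile (rho z w) * ((1 + gRatio (rho z w)) ^ 2 / 16 - (1 + gRatio (rho z w)) / 4 -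
        gFun (rho z w) / gDer (rho z w) * gRatio' (rho z w) / 8) := by
  have hN := (gDer_pos hzw.rho_gt.le).ne'
  have hg := (gFun_pos hzw.rho_gt).ne'
  have hx := hzw.1.ne'
  have hρ := hzw.hasDerivAt_rho_x₁
  have h1 := ((((((hasDerivAt_gRatio hzw.rho_gt).comp z.2.1 hρ).const_add 1).mul
    ((hasDerivAt_uProfile hzw.rho_gt).comp z.2.1 hρ)).const_mul (1 / 4)).div
    (hasDerivAt_id z.2.1) hx)
  have h2 : (fun r => partialX₁ (fun ζ => uCorr ζ w) (z.1, r, z.2.2)) =ᶠ[𝓝 z.2.1] _ :=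
    hzw.eventually_x₁.mono fun r hr => hr.partialX₁_uCorr
  have h3 : gDer₂ (rho z w) = gRatio (rho z w) * gDer (rho z w) ^ 2 / gFun (rho z w) := by
    rw [gRatio]
    field_simp
  rw [partialX₁, (h1.congr_of_eventuallyEq h2).deriv]
  simp only [Function.comp, id, Pi.mul_apply]
  rw [h3]
  field_simp
  ring

theorem hFun_eq_inv : hFun z w = (gFun (rho z w))⁻¹ := by
  rw [hzw.gFun_rho, one_div, inv_inv]

theorem rho_nonneg (h : hFun z w ≤ 1) : 0 ≤ rho z w := by
  have hp := pow_pos pi_pos 2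
  rw [← strictMonoOn_gFun.le_iff_le (a := 0) (b := rho z w) (by simpa using hp.le)
    hzw.rho_gt.le, gFun_zero, hzw.gFun_rho]
  exact (one_le_div₀ hzw.hFun_pos).2 h

end Prec

theorem exists_bounds : ∃ κ : ℝ, 0 < κ ∧ ∀ z w : Pt, Prec z w →
    κ⁻¹ * (Ioc (0 : ℝ) 1).indicator (fun _ => (1 : ℝ)) (hFun z w) * hFun z w ≤ |uCorr z w| ∧
    |uCorr z w| ≤ κ * (√(hFun z w) + hFun z w) ∧
    |z.2.1 ^ 2 * partialX₁ (partialX₁ fun ζ => uCorr ζ w) z| ≤ κ * √(hFun z w) := by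
  obtain ⟨K, hK, hu⟩ := exists_uProfile_le
  obtain ⟨L, hL, hR⟩ := exists_gRatio_bound
  set B := (1 + L) ^ 2 / 16 + (1 + L) / 4 + L / 8 with hB
  have hB0 : 0 < B := by positivity
  -- The 1 makes κ⁻¹ ≤ 1 for the lower bound; K and KB serve the two upper bounds.
  refine ⟨1 + K + K * B, by positivity, fun z w hzw => ?_⟩
  have hr := hzw.rho_gt
  have hU := uProfile_pos hr
  have hh := hzw.hFun_pos
  have hUK : uProfile (rho z w) ≤ K * √(hFun z w) := by
    rw [hzw.hFun_eq_inv, Real.sqrt_inv]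
    exact hu _ hr
  have hq := Real.sqrt_nonneg (hFun z w)
  have hKB : 0 < K * B := mul_pos hK hB0
  refine ⟨?_, ?_, ?_⟩
  · rw [hzw.uCorr_eq, abs_of_pos hU]
    by_cases h : hFun z w ≤ 1
    · rw [indicator_of_mem (show hFun z w ∈ Ioc 0 1 from ⟨hh, h⟩), mul_one]
      have h1 := inv_gFun_le_uProfile (hzw.rho_nonneg h)
      rw [← hzw.hFun_eq_inv] at h1
      refine le_trans ?_ h1
      exact mul_le_of_le_one_left hh.le (inv_le_one_of_one_le₀ (by linarith))
    · rw [indicator_of_notMem (show hFun z w ∉ Ioc 0 1 from fun h' => h h'.2), mul_zero, zero_mul]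
      exact hU.le
  · rw [hzw.uCorr_eq, abs_of_pos hU]
    refine hUK.trans ?_
    nlinarith
  · rw [hzw.sq_mul_partialX₁_partialX₁_uCorr, abs_mul, abs_of_pos hU]
    obtain ⟨h1, h2⟩ := hR _ hr
    have h3 : |(1 + gRatio (rho z w)) ^ 2 / 16 - (1 + gRatio (rho z w)) / 4 -
        gFun (rho z w) / gDer (rho z w) * gRatio' (rho z w) / 8| ≤ B := by
      have h4 : |1 + gRatio (rho z w)| ≤ 1 + L := (abs_add_le _ _).trans (by simpa using h1)
      have h5 : (1 + gRatio (rho z w)) ^ 2 ≤ (1 + L) ^ 2 := sq_le_sq' (abs_le.1 h4).1 (abs_le.1 h4).2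
      rw [abs_le] at *
      have := sq_nonneg (1 + gRatio (rho z w))
      constructor <;> linarith [h4.1, h4.2, h2.1, h2.2]
    calc uProfile (rho z w) * _ ≤ K * √(hFun z w) * B := by gcongr
      _ ≤ _ := by nlinarith [mul_nonneg hK.le hq]

end AsianTransport

theorem proposition4p3 :
    -- the objects entering the definition of `u` and the closed form are well defined
    BijOn gFun (Ioi (-π ^ 2)) (Ioi 0) ∧
    (∀ z w : Pt, Prec z w →
      (∃ γ, IsOptimalCurve z w γ) ∧
      (∀ γ₁ γ₂, IsOptimalCurve z w γ₁ → IsOptimalCurve z w γ₂ →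
        EqOn γ₁ γ₂ (Icc z.1 w.1)) ∧
      ContDiffOn ℝ 2 (fun r => Psi (z.1, r, z.2.2) w) (Ioi 0) ∧
      (∀ γ, IsOptimalCurve z w γ →
        (∀ s ∈ Ico z.1 w.1, Prec (s, γ s) w) ∧
        IntervalIntegrable (fun s => fCoeff (s, γ s) w) volume z.1 w.1 ∧
        uCorr z w = Real.exp (∫ s in z.1..w.1, fCoeff (s, γ s) w))) ∧
    -- closed form
    (∀ z w : Pt, Prec z w → uCorr z w = vFun (4 * gInv (1 / hFun z w))) ∧
    -- smoothness and transport equation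
    (∀ w : Pt, InDomain w → ContDiffOn ℝ ∞ (fun z => uCorr z w) {z | Prec z w}) ∧
    (∀ z w : Pt, Prec z w →
      fieldY (fun ζ => uCorr ζ w) z - driftCoeff z w * partialX₁ (fun ζ => uCorr ζ w) z
        + fCoeff z w * uCorr z w = 0) ∧
    -- bounds
    (∃ κ : ℝ, 0 < κ ∧ ∀ z w : Pt, Prec z w →
      κ⁻¹ * (Ioc (0 : ℝ) 1).indicator (fun _ => (1 : ℝ)) (hFun z w) * hFun z w ≤ |uCorr z w| ∧
      |uCorr z w| ≤ κ * (√(hFun z w) + hFun z w) ∧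
      |z.2.1 ^ 2 * partialX₁ (partialX₁ fun ζ => uCorr ζ w) z| ≤ κ * √(hFun z w)) := by
  refine ⟨bijOn_gFun, fun z w hzw => ⟨⟨_, hzw.isOptimalCurve_extremal⟩,
    fun γ₁ γ₂ h₁ h₂ => (hzw.eqOn_extremal h₁).trans (hzw.eqOn_extremal h₂).symm,
    hzw.contDiffOn_psi, fun γ h => ?_⟩,
    fun z w hzw => hzw.uCorr_eq.trans (vFun_four_mul hzw.rho_gt).symm,
    fun w _ => contDiffOn_uCorr w, fun z w hzw => hzw.transport, exists_bounds⟩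
  have hγ := hzw.eqOn_extremal h
  refine ⟨fun s hs => ?_, hzw.intervalIntegrable_fCoeff hγ, ?_⟩
  · rw [hγ (Ico_subset_Icc_self hs)]
    exact hzw.prec_extremal hs
  · rw [hzw.uCorr_eq, hzw.exp_integral_fCoeff hγ]
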